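/- For $\tau\in\mathbb C$ let $X_\tau$ be the vector field on $\mathbb C^2$ $$X_\tau(z,w)=2\pi i\begin{pmatrix}(1-\tau)z+\tfrac12 z^2-\tfrac13 w^3\\ \tau w-zw\end{pmatrix}.$$ For $a\in\mathbb C^d$ and $r>0$ let $\mathbb D_{\mathbb C^d}(a,r)$ be the open polydisk with centre $a$ and all radii equal to $r$ ($\mathbb D=\mathbb D_{\mathbb C}$), and for $s>0$ let $\mathbb T_s=(\mathbb R+i(-s,s))/\mathbb Z$. For a holomorphic vector field $X$ on an open set $U$ and $t\in\mathbb C$, $\phi^t_X$ denotes the time-one map of the vector field $tX$ on $U$ (where it is defined). Let $(p(t))_{t\in\mathbb R}$ be a periodic orbit of $X_1$ with minimal period $|T_*|$, where $T_*=1/g_*$, $g_*\in\mathbb R$ and $|g_*+0.834|\le 10^{-3}$ (for instance the exotic periodic orbit of $X_1$), and put $p_*=p(0)$. Let $M>0$ be such that the orbit lies in $\mathbb D(0,M/2)^2$, and let $e\in\mathbb C^2$ satisfy $\mathbb C^2=\mathbb Ce\oplus\mathbb CX_1(p_*)$. Let $\mathring\beta\in\mathbb C$, $\nu_0>0$, and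 let $$(\tau',\delta,z,w)\mapsto X_{\delta,\tau'}(z,w)\in\mathbb C^2,\qquad \tau'\in\mathbb D_{\mathbb C^2}((1,\mathring\beta),\nu_0),\ \delta\in\mathbb D(0,\nu_0),\ (z,w)\in\mathbb D(0,M)^2,$$ be a holomorphic map such that $X_{0,(1,\beta)}=X_1$ on $\mathbb D(0,M)^2$ for all $\beta\in\mathbb D(\mathring\beta,\nu_0)$ and $\operatorname{div}X_{\delta,\tau'}=2\pi i$ for all $(\tau',\delta)$. (This holds in particular for $X_{\delta,\tau'}=X_\tau+O(\delta)$, $\tau'=(\tau,\beta)$, holomorphic in all variables and of divergence $2\pi i$.) The flow of $X_{\delta,\tau'}$ below is taken in $U=\mathbb D(0,M)^2$. Then there exist $0<\nu_1\le\nu_0$, $\nu_1'>0$, $s_*>0$ and holomorphic functions $(\tau',\delta)\mapsto g_\delta(\tau')\in\mathbb C$ and $(\tau',\delta)\mapsto\zeta_\delta(\tau')\in\mathbb C$ on $\mathbb D_{\mathbb C^2}((1,\mathring\beta),\nu_1)\times\mathbb D(0,\nu_1)$ such that: 1. $g_0(1,\beta)=g_*$ and $\zeta_0(1,\beta)=0$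 for all $\beta\in\mathbb D(\mathring\beta,\nu_1)$. 2. For every $(\tau',\delta)\in\mathbb D_{\mathbb C^2}((1,\mathring\beta),\nu_1)\times\mathbb D(0,\nu_1)$, the pair $(g_\delta(\tau'),\zeta_\delta(\tau'))$ is the unique $(g,\zeta)\in\mathbb D(g_*,\nu_1')\times\mathbb D(0,\nu_1')$ with $$\phi^{1/g}_{X_{\delta,\tau'}}(p_*+\zeta e)=p_*+\zeta e.$$ 3. For every such $(\tau',\delta)$ the map $\psi_{\delta,\tau'}(\theta)=\phi^{\theta/g_\delta(\tau')}_{X_{\delta,\tau'}}(p_*+\zeta_\delta(\tau')e)$ is well defined on $\mathbb T_{s_*}$, with values in $\mathbb D(0,M)^2$; it depends holomorphically on $(\tau',\delta,\theta)$, and it is a holomorphic embedding (an immersion that is a homeomorphism onto its image) of $\mathbb T_{s_*}$. The vector field $X_{\delta,\tau'}$ is tangent to the annulus $\mathcal A_{\delta,\tau'}=\psi_{\delta,\tau'}(\mathbb T_{s_*})$, and $\psi_{\delta,\tau'}$ conjugates $g_\delta(\tau')\partial_\theta$ on $\mathbb T_{s_*}$ to the restriction of $X_{\delta,\tau'}$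 to $\mathcal A_{\delta,\tau'}$: $(\psi_{\delta,\tau'})_*(g_\delta(\tau')\partial_\theta)=X_{\delta,\tau'}$. -/

import Mathlib

open Metric Set

/-- The polynomial vector field `X_τ` on `ℂ²`,
`X_τ(z, w) = 2πi ((1 - τ) z + z² / 2 - w³ / 3, τ w - z w)`. -/
noncomputable def modelField (τ : ℂ) (p : ℂ × ℂ) : ℂ × ℂ :=
  (2 * Real.pi * Complex.I * ((1 - τ) * p.1 + p.1 ^ 2 / 2 - p.2 ^ 3 / 3),
    2 * Real.pi * Complex.I * (τ * p.2 - p.1 * p.2))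

/-- The divergence `∂_z X_z + ∂_w X_w` of a holomorphic vector field at a point. -/
noncomputable def divergence (X : ℂ × ℂ → ℂ × ℂ) (p : ℂ × ℂ) : ℂ :=
  (fderiv ℂ X p (1, 0)).1 + (fderiv ℂ X p (0, 1)).2

/-- `γ` is a (real-time) integral curve of `X`, defined for all times, which is periodic
and whose minimal period is `|T|`, with `T ≠ 0` (`T` may be negative). -/
structure IsPeriodicOrbit (X : ℂ × ℂ → ℂ × ℂ) (T : ℝ) (γ : ℝ → ℂ × ℂ) : Prop where
  period_ne_zero : T ≠ 0
  solution : ∀ t : ℝ, HasDerivAt γ (X (γ t)) t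
  periodic : Function.Periodic γ T
  minimal : ∀ t : ℝ, 0 < t → t < |T| → γ t ≠ γ 0

/-- `φ^t_X(p)` is defined and equal to `q`, for a vector field `X` on `U` and a complex time `t`:
the complex-time flow is followed along the segment from `0` to `t`, that is
`φ^t_X` is the time-one map of the vector field `t X` on `U`. -/
def FlowEq (X : ℂ × ℂ → ℂ × ℂ) (U : Set (ℂ × ℂ)) (t : ℂ) (p q : ℂ × ℂ) : Prop :=
  ∃ c : ℝ → ℂ × ℂ, c 0 = p ∧ c 1 = q ∧
    ∀ r ∈ Icc (0 : ℝ) 1, c r ∈ U ∧ HasDerivWithinAt c (t • X (c r)) (Icc (0 : ℝ) 1) r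

/-- The horizontal strip `ℝ + i(-s, s)`. -/
def strip (s : ℝ) : Set ℂ := {θ : ℂ | |θ.im| < s}

/-- The bi-infinite cylinder `ℂ / ℤ`. -/
abbrev Cylinder : Type := ℂ ⧸ AddSubgroup.zmultiples (1 : ℂ)

/-- The annulus `𝕋_s = (ℝ + i(-s, s)) / ℤ`, as a subset of `ℂ / ℤ`. -/
def annulus (s : ℝ) : Set Cylinder := (fun θ : ℂ => (θ : Cylinder)) '' strip s

/-- `X` is a family `(τ', δ, z, w) ↦ X_{δ,τ'}(z, w)`, `τ' = (τ, β)`, of vector fields on the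
polydisk `𝔻(0, M)²`, holomorphic in all variables for `τ'` in the polydisk of centre `(1, β₀)`
and radius `ν₀` and `|δ| < ν₀`, which extends `X_1` and has constant divergence `2πi`.
(The norm of `ℂ × ℂ` is the maximum norm, so that its balls are the polydisks.) -/
structure IsPerturbation (β₀ : ℂ) (ν₀ M : ℝ) (X : ℂ → ℂ × ℂ → ℂ × ℂ → ℂ × ℂ) : Prop where
  holomorphic : DifferentiableOn ℂ
    (fun q : (ℂ × ℂ) × ℂ × (ℂ × ℂ) => X q.2.1 q.1 q.2.2)
    (ball ((1 : ℂ), β₀) ν₀ ×ˢ ball (0 : ℂ) ν₀ ×ˢ ball (0 : ℂ × ℂ) M)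
  unperturbed : ∀ β ∈ ball β₀ ν₀, ∀ p ∈ ball (0 : ℂ × ℂ) M, X 0 (1, β) p = modelField 1 p
  divergence_eq : ∀ τ' ∈ ball ((1 : ℂ), β₀) ν₀, ∀ δ ∈ ball (0 : ℂ) ν₀,
    ∀ p ∈ ball (0 : ℂ × ℂ) M, divergence (X δ τ') p = 2 * Real.pi * Complex.I

/-- `Ψ` embeds the annulus `𝕋_s` holomorphically in `U`, the vector field `X` is tangent to its
image, and `Ψ` conjugates the constant vector field `g ∂_θ` on `𝕋_s` to the restriction of `X` to
the image: `Ψ_* (g ∂_θ) = X`. -/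
structure IsInvariantAnnulus (X : ℂ × ℂ → ℂ × ℂ) (U : Set (ℂ × ℂ)) (s : ℝ) (g : ℂ)
    (Ψ : Cylinder → ℂ × ℂ) : Prop where
  mapsTo : MapsTo Ψ (annulus s) U
  isEmbedding : Topology.IsEmbedding ((annulus s).domRestrict Ψ)
  conjugates : ∀ θ ∈ strip s, ∃ v : ℂ × ℂ, v ≠ 0 ∧
    HasDerivAt (fun u : ℂ => Ψ (u : Cylinder)) v θ ∧ X (Ψ (θ : Cylinder)) = g • v

/-!
A periodic orbit of a vector field of constant divergence `2πi` in `ℂ²` is nondegenerate as soon as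
its period `T` satisfies `exp (2πi T) ≠ 1`. One eigenvalue of the monodromy is `1`, in the direction
of the field, and by Liouville's formula (`det₂_variational_eq`) the determinant of the monodromy is
`exp (2πi T)`; hence the other eigenvalue differs from `1`. Here `T = 1 / g_*` with `g_*` close to
`-0.834`, so `T` is not an integer. The equation `φ^{1/g} (p_* + ζ e) = p_* + ζ e` in the unknowns
`(g, ζ)` therefore has an invertible linearization, and the implicit function theorem gives the
holomorphic functions `g`, `ζ` and their uniqueness (`exists_periodic_continuation`).

This requires the holomorphic dependence of the flow on complex time, initial point and parameters,
on an open domain (`flow_family_regularity`). It is obtained from the implicit function theorem in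
the Banach space `C([0, 1], ℂ²)`, applied to the integral equation (`exists_local_flow`). The
hypotheses of that theorem hold because holomorphic maps between complex normed spaces are `C¹`
(`contDiffAt_one_of_differentiableOn`), the superposition operator of a holomorphic map is
holomorphic (`exists_hasFDerivAt_superpose`), and operators of Volterra type are quasi-nilpotent
(`isUnit_one_sub_volterra_comp`).

The annulus is the image of the complex-time flow of the periodic point. By compactness of a real
period, the flow is defined for the times `θ / g` with `θ` in a complex rectangle that is uniform in
the parameters; uniqueness of solutions glues the translates of this rectangle to a strip, on which
the flow is periodic (`flowEq_periodicFlow`). Injectivity modulo `ℤ` holds for the real orbit by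
minimality of the period, and it persists on a thin strip by compactness: strict differentiability
takes care of the pairs of points near the diagonal, continuity of the others
(`eventually_injective`, `exists_uniform_strip`).
-/

open Filter Topology

/-! ### Holomorphic maps between normed spaces are continuously differentiable -/

section Holomorphic

variable {E F : Type*} [NormedAddCommGroup E] [NormedSpace ℂ E]
  [NormedAddCommGroup F] [NormedSpace ℂ F]

/-- Cauchy's estimate for the Fréchet derivative, by restriction to complex lines. -/
theorem norm_fderiv_le_of_differentiableOn_ball {f : E → F} {x : E} {R r C : ℝ} (hr : 0 < r)
    (hrR : r < R) (hf : DifferentiableOn ℂ f (ball x R)) (hC : ∀ y ∈ ball x R, ‖f y‖ ≤ C) :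
    ‖fderiv ℂ f x‖ ≤ C / r := by
  have hxR : x ∈ ball x R := mem_ball_self (hr.trans hrR)
  have hC0 : 0 ≤ C := (norm_nonneg _).trans (hC x hxR)
  refine ContinuousLinearMap.opNorm_le_bound _ (by positivity) fun v => ?_
  rcases eq_or_ne v 0 with rfl | hv
  · simp
  have hv' : 0 < ‖v‖ := norm_pos_iff.2 hv
  have hline : ∀ t ∈ closedBall (0 : ℂ) (r / ‖v‖), x + t • v ∈ ball x R := by
    intro t ht
    rw [mem_closedBall_zero_iff, le_div_iff₀ hv'] at ht
    simpa [norm_smul] using ht.trans_lt hrR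
  have hder : ∀ t ∈ closedBall (0 : ℂ) (r / ‖v‖),
      HasDerivAt (fun t : ℂ => f (x + t • v)) (fderiv ℂ f (x + t • v) v) t := by
    intro t ht
    have h1 := (hf.differentiableAt (isOpen_ball.mem_nhds (hline t ht))).hasFDerivAt
    have h2 : HasDerivAt (fun t : ℂ => x + t • v) v t := by
      simpa using ((hasDerivAt_id t).smul_const v).const_add x
    exact h1.comp_hasDerivAt t h2
  have hdc : DiffContOnCl ℂ (fun t : ℂ => f (x + t • v)) (ball 0 (r / ‖v‖)) := by
    apply DifferentiableOn.diffContOnCl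
    rw [closure_ball _ (by positivity)]
    exact fun t ht => (hder t ht).differentiableAt.differentiableWithinAt
  have key := Complex.norm_deriv_le_of_forall_mem_sphere_norm_le (div_pos hr hv') hdc
    (fun t ht => hC _ (hline t (sphere_subset_closedBall ht)))
  rw [(hder 0 (by simp; positivity)).deriv] at key
  simp only [zero_smul, add_zero] at key
  calc _ ≤ _ := key
    _ = _ := by field_simp

/-- A holomorphic map between complex normed spaces is `C¹`: by Cauchy's estimate it is locally
Lipschitz, and Cauchy's estimate for the difference of two translates of the map then shows that
its derivative is locally Lipschitz. -/
theorem contDiffAt_one_of_differentiableOn {f : E → F} {U : Set E} (hU : IsOpen U)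
    (hf : DifferentiableOn ℂ f U) {x : E} (hx : x ∈ U) : ContDiffAt ℂ 1 f x := by
  rw [contDiffAt_one_iff]
  refine ⟨fderiv ℂ f, U, hU.mem_nhds hx, fun x hx => ContinuousAt.continuousWithinAt ?_,
    fun y hy => (hf.differentiableAt (hU.mem_nhds hy)).hasFDerivAt⟩
  have hcont : ContinuousAt f x := (hf.differentiableAt (hU.mem_nhds hx)).continuousAt
  obtain ⟨ρ, hρ, hball⟩ := Metric.mem_nhds_iff.1
    (inter_mem (hU.mem_nhds hx) (hcont (ball_mem_nhds (f x) one_pos)))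
  obtain ⟨r, rfl⟩ : ∃ r, ρ = 4 * r := ⟨ρ / 4, by ring⟩
  have hr : 0 < r := by linarith
  have hd : ∀ y ∈ ball x (4 * r), DifferentiableAt ℂ f y := fun y hy =>
    hf.differentiableAt (hU.mem_nhds (hball hy).1)
  have hb : ∀ y ∈ ball x (4 * r), ‖f y‖ ≤ 1 + ‖f x‖ := by
    intro y hy
    have h1 : dist (f y) (f x) < 1 := (hball hy).2
    rw [dist_eq_norm] at h1
    have := norm_le_norm_sub_add (f y) (f x)
    linarith
  set C := (1 + ‖f x‖) / r with hCdef
  have hC0 : 0 ≤ C := by positivity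
  have hD : ∀ y ∈ ball x (2 * r), ‖fderiv ℂ f y‖ ≤ C := by
    intro y hy
    have hsub : ball y (2 * r) ⊆ ball x (4 * r) := by
      apply ball_subset_ball'
      rw [mem_ball] at hy
      linarith
    exact norm_fderiv_le_of_differentiableOn_ball hr (by linarith : r < 2 * r)
      (fun z hz => (hd z (hsub hz)).differentiableWithinAt) fun z hz => hb z (hsub hz)
  have hL : ∀ y ∈ ball x (2 * r), ∀ z ∈ ball x (2 * r), ‖f y - f z‖ ≤ C * ‖y - z‖ := by
    intro y hy z hz
    let : NormedSpace ℝ E := .restrictScalars ℝ ℂ E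
    exact (convex_ball x (2 * r)).norm_image_sub_le_of_norm_fderiv_le
      (fun w hw => hd w (ball_subset_ball (by linarith) hw)) hD hz hy
  have hDL : ∀ y ∈ ball x r, ‖fderiv ℂ f y - fderiv ℂ f x‖ ≤ (C / (r / 2)) * ‖y - x‖ := by
    intro y hy
    have hyn : ‖y - x‖ < r := by simpa [dist_eq_norm] using hy
    have htr : ∀ w ∈ ball x r, w + (y - x) ∈ ball x (2 * r) := by
      intro w hw
      rw [mem_ball, dist_eq_norm] at hw ⊢
      calc ‖w + (y - x) - x‖ = ‖(w - x) + (y - x)‖ := by congr 1; abel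
        _ ≤ ‖w - x‖ + ‖y - x‖ := norm_add_le _ _
        _ < _ := by linarith
    have hw2 : ∀ w ∈ ball x r, w ∈ ball x (2 * r) := fun w hw =>
      ball_subset_ball (by linarith) hw
    have hg : ∀ w ∈ ball x r, HasFDerivAt (fun w => f (w + (y - x)) - f w)
        (fderiv ℂ f (w + (y - x)) - fderiv ℂ f w) w := by
      intro w hw
      refine HasFDerivAt.sub ?_ (hd w (ball_subset_ball (by linarith) hw)).hasFDerivAt
      have h1 := (hd _ (ball_subset_ball (by linarith) (htr w hw))).hasFDerivAt
      exact h1.comp w ((hasFDerivAt_id w).add_const (y - x))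
    have key := norm_fderiv_le_of_differentiableOn_ball (half_pos hr) (half_lt_self hr)
      (fun w hw => (hg w hw).differentiableAt.differentiableWithinAt)
      (C := C * ‖y - x‖) (fun w hw => by
        simpa using hL _ (htr w hw) _ (hw2 w hw))
    rw [(hg x (mem_ball_self hr)).fderiv, add_sub_cancel] at key
    exact key.trans_eq (by ring)
  rw [ContinuousAt, tendsto_iff_norm_sub_tendsto_zero]
  refine squeeze_zero' (Eventually.of_forall fun _ => norm_nonneg _)
    (eventually_of_mem (ball_mem_nhds x hr) hDL) ?_
  have : Tendsto (fun y => (C / (r / 2)) * ‖y - x‖) (𝓝 x) (𝓝 ((C / (r / 2)) * ‖x - x‖)) :=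
    (by fun_prop : Continuous fun y => (C / (r / 2)) * ‖y - x‖).tendsto x
  simpa using this

end Holomorphic

/-! ### Superposition and Volterra operators -/

section Superposition

variable {K A F : Type*} [TopologicalSpace K] [NormedAddCommGroup A] [NormedAddCommGroup F]

/-- The superposition (Nemytskii) operator `c ↦ f ∘ c` on continuous functions; its value is the
junk value `0` where `f ∘ c` is not continuous. -/
noncomputable def superpose (f : A → F) (c : C(K, A)) : C(K, F) :=
  ContinuousMap.mkD (fun r => f (c r)) 0

theorem superpose_apply {f : A → F} {W : Set A} (hf : ContinuousOn f W) {c : C(K, A)}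
    (hc : ∀ r, c r ∈ W) (r : K) : superpose f c r = f (c r) := by
  have : Continuous fun r => f (c r) := hf.comp_continuous c.continuous hc
  simp [superpose, ContinuousMap.mkD_of_continuous this]

theorem isOpen_setOf_forall_mem [CompactSpace K] {W : Set A} (hW : IsOpen W) :
    IsOpen {c : C(K, A) | ∀ r, c r ∈ W} := by
  simpa [MapsTo] using ContinuousMap.isOpen_setOfPred_mapsTo (isCompact_univ (X := K)) hW

variable [CompactSpace K] [NormedSpace ℂ A] [NormedSpace ℂ F]

/-- Pointwise application of a continuous family of operators to a continuous function. -/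
noncomputable def pointwiseApply (D : C(K, A →L[ℂ] F)) : C(K, A) →L[ℂ] C(K, F) :=
  LinearMap.mkContinuous
    { toFun := fun h => ⟨fun r => D r (h r), by fun_prop⟩
      map_add' := fun h k => by ext r; simp
      map_smul' := fun a h => by ext r; simp } ‖D‖ (fun h => by
    refine (ContinuousMap.norm_le _ (by positivity)).2 fun r => ?_
    exact (D r).le_of_opNorm_le_of_le (D.norm_coe_le_norm r) (h.norm_coe_le_norm r))

@[simp]
theorem pointwiseApply_apply (D : C(K, A →L[ℂ] F)) (h : C(K, A)) (r : K) :
    pointwiseApply D h r = D r (h r) := rfl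

/-- The superposition operator of a holomorphic map is differentiable; the compactness of `K`
makes the pointwise remainder estimate uniform. -/
theorem exists_hasFDerivAt_superpose {f : A → F} {W : Set A} (hW : IsOpen W)
    (hf : DifferentiableOn ℂ f W) {c : C(K, A)} (hc : ∀ r, c r ∈ W) :
    ∃ D : C(K, A →L[ℂ] F), (∀ r, D r = fderiv ℂ f (c r)) ∧
      HasFDerivAt (superpose f) (pointwiseApply D) c := by
  have hC1 : ∀ x ∈ W, ContDiffAt ℂ 1 f x := fun x hx => contDiffAt_one_of_differentiableOn hW hf hx
  have hDcont : Continuous fun r => fderiv ℂ f (c r) :=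
    ContinuousOn.comp_continuous (s := W)
      (fun x hx => ((hC1 x hx).continuousAt_fderiv one_ne_zero).continuousWithinAt) c.continuous hc
  refine ⟨⟨_, hDcont⟩, fun r => rfl, ?_⟩
  rw [hasFDerivAt_iff_isLittleO_nhds_zero, Asymptotics.isLittleO_iff]
  intro ε hε
  have hloc : ∀ r ∈ (univ : Set K), ∀ᶠ z : A × K in 𝓝 (0, r),
      ‖f (c z.2 + z.1) - f (c z.2) - fderiv ℂ f (c z.2) z.1‖ ≤ ε * ‖z.1‖ := by
    intro r _
    have hs := (hC1 _ (hc r)).hasStrictFDerivAt one_ne_zero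
    have h1 := Asymptotics.isLittleO_iff.1 hs.isLittleO (half_pos hε)
    have ht : Tendsto (fun z : A × K => (c z.2 + z.1, c z.2)) (𝓝 (0, r)) (𝓝 (c r, c r)) := by
      have : Continuous fun z : A × K => (c z.2 + z.1, c z.2) := by fun_prop
      simpa using this.tendsto (0, r)
    have ht2 : Tendsto (fun z : A × K => fderiv ℂ f (c z.2)) (𝓝 (0, r))
        (𝓝 (fderiv ℂ f (c r))) :=
      (hDcont.comp continuous_snd).tendsto (0, r)
    filter_upwards [ht.eventually h1, ht2 (ball_mem_nhds _ (half_pos hε))] with z hz1 hz2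
    simp only [add_sub_cancel_left] at hz1
    have hz2' : ‖fderiv ℂ f (c z.2) - fderiv ℂ f (c r)‖ < ε / 2 := by
      simpa [dist_eq_norm] using hz2
    calc ‖f (c z.2 + z.1) - f (c z.2) - fderiv ℂ f (c z.2) z.1‖
        = ‖(f (c z.2 + z.1) - f (c z.2) - fderiv ℂ f (c r) z.1)
            - (fderiv ℂ f (c z.2) - fderiv ℂ f (c r)) z.1‖ := by
          congr 1; simp
      _ ≤ ε / 2 * ‖z.1‖ + ε / 2 * ‖z.1‖ :=
          (norm_sub_le _ _).trans (add_le_add hz1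
            (ContinuousLinearMap.le_of_opNorm_le _ hz2'.le _))
      _ = ε * ‖z.1‖ := by ring
  have hunif := isCompact_univ.eventually_forall_of_forall_eventually
    (P := fun h r => ‖f (c r + h) - f (c r) - fderiv ℂ f (c r) h‖ ≤ ε * ‖h‖) hloc
  obtain ⟨δ, hδ, hball⟩ := Metric.eventually_nhds_iff_ball.1 hunif
  have hcW : ∀ᶠ h : C(K, A) in 𝓝 0, ∀ r, c r + h r ∈ W := by
    have : Tendsto (fun h : C(K, A) => c + h) (𝓝 0) (𝓝 c) := by
      simpa using (continuous_const_add c).tendsto 0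
    exact this.eventually ((isOpen_setOf_forall_mem hW).mem_nhds hc)
  filter_upwards [ball_mem_nhds 0 hδ, hcW] with h hh hhW
  refine (ContinuousMap.norm_le _ (by positivity)).2 fun r => ?_
  have hhr : ‖h r‖ ≤ ‖h‖ := h.norm_coe_le_norm r
  have h2 := hball (h r) (by simpa using hhr.trans_lt (by simpa using hh)) r (mem_univ r)
  have e1 : superpose f (c + h) r = f (c r + h r) :=
    superpose_apply hf.continuousOn (c := c + h) hhW r
  have e2 : superpose f c r = f (c r) := superpose_apply hf.continuousOn hc r
  simp only [ContinuousMap.sub_apply, pointwiseApply_apply, e1, e2, ContinuousMap.coe_mk]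
  exact h2.trans (by gcongr)

end Superposition

section Volterra

variable {E : Type*} [NormedAddCommGroup E]

/-- A continuous function on `[0, 1]`, extended by constants to `ℝ`. -/
noncomputable abbrev extendPath (h : C(Icc (0 : ℝ) 1, E)) : ℝ → E :=
  IccExtend zero_le_one h

theorem continuous_extendPath (h : C(Icc (0 : ℝ) 1, E)) : Continuous (extendPath h) :=
  h.continuous.Icc_extend'

variable [NormedSpace ℂ E]

theorem norm_integral_extendPath_le (h : C(Icc (0 : ℝ) 1, E)) (r : Icc (0 : ℝ) 1) :
    ‖∫ s in (0 : ℝ)..r, extendPath h s‖ ≤ ‖h‖ := by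
  have h1 := intervalIntegral.norm_integral_le_of_norm_le_const (a := (0 : ℝ)) (b := r)
    (f := extendPath h) (C := ‖h‖) (fun s _ => h.norm_coe_le_norm _)
  refine h1.trans ?_
  rw [sub_zero, abs_of_nonneg r.2.1]
  exact mul_le_of_le_one_right (norm_nonneg _) r.2.2

/-- The Volterra operator: integration from `0` on `C([0, 1], E)`. -/
noncomputable def volterra : C(Icc (0 : ℝ) 1, E) →L[ℂ] C(Icc (0 : ℝ) 1, E) :=
  LinearMap.mkContinuous
    { toFun := fun h => ⟨fun r => ∫ s in (0 : ℝ)..r, extendPath h s,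
        (intervalIntegral.continuous_primitive
          (fun a b => (continuous_extendPath h).intervalIntegrable a b) 0).comp
            continuous_subtype_val⟩
      map_add' := fun h k => by
        ext r
        exact intervalIntegral.integral_add ((continuous_extendPath h).intervalIntegrable _ _)
          ((continuous_extendPath k).intervalIntegrable _ _)
      map_smul' := fun a h => by
        ext r
        exact intervalIntegral.integral_smul a (extendPath h) } 1 (fun h => by
    rw [one_mul]
    exact (ContinuousMap.norm_le _ (norm_nonneg _)).2 fun r => norm_integral_extendPath_le h r)

theorem volterra_apply (h : C(Icc (0 : ℝ) 1, E)) (r : Icc (0 : ℝ) 1) :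
    volterra h r = ∫ s in (0 : ℝ)..r, extendPath h s := rfl

theorem volterra_zero (h : C(Icc (0 : ℝ) 1, E)) : volterra h ⟨0, by simp⟩ = 0 := by
  simp [volterra_apply]

theorem hasDerivWithinAt_volterra [CompleteSpace E] (h : C(Icc (0 : ℝ) 1, E)) {r : ℝ}
    (hr : r ∈ Icc (0 : ℝ) 1) :
    HasDerivWithinAt (extendPath (volterra h)) (h ⟨r, hr⟩) (Icc 0 1) r := by
  have h1 : HasDerivAt (fun u => ∫ s in (0 : ℝ)..u, extendPath h s) (extendPath h r) r :=
    intervalIntegral.integral_hasDerivAt_right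
      ((continuous_extendPath h).intervalIntegrable _ _)
      (continuous_extendPath h).stronglyMeasurable.stronglyMeasurableAtFilter
      (continuous_extendPath h).continuousAt
  rw [extendPath, IccExtend_of_mem _ _ hr] at h1
  refine h1.hasDerivWithinAt.congr_of_mem (fun s hs => ?_) hr
  rw [extendPath, IccExtend_of_mem _ _ hs, volterra_apply]

/-- An operator which is the composition of the Volterra operator with a pointwise bounded operator
is quasi-nilpotent: its `n`-th power has norm at most `Lⁿ / n!`. -/
theorem norm_volterra_comp_pow_le {T : C(Icc (0 : ℝ) 1, E) →L[ℂ] C(Icc (0 : ℝ) 1, E)} {L : ℝ}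
    (hL : 0 ≤ L) (hT : ∀ h r, ‖T h r‖ ≤ L * ‖h r‖) (n : ℕ) (h : C(Icc (0 : ℝ) 1, E))
    (r : Icc (0 : ℝ) 1) :
    ‖((volterra ∘L T) ^ n) h r‖ ≤ L ^ n / n.factorial * ‖h‖ * (r : ℝ) ^ n := by
  induction n generalizing r with
  | zero => simpa using h.norm_coe_le_norm r
  | succ n ih =>
    rw [pow_succ', mul_apply_eq_comp, ContinuousLinearMap.comp_apply, volterra_apply]
    set k := ((volterra ∘L T) ^ n) h
    set B := L ^ n / n.factorial * ‖h‖
    have hint : ∫ s in (0 : ℝ)..r, L * (B * s ^ n) =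
        L ^ (n + 1) / (n + 1).factorial * ‖h‖ * (r : ℝ) ^ (n + 1) := by
      rw [intervalIntegral.integral_const_mul, intervalIntegral.integral_const_mul, integral_pow]
      simp only [B, Nat.factorial_succ]
      push_cast
      field_simp
      simp [pow_succ]
      ring
    rw [← hint]
    refine intervalIntegral.norm_integral_le_of_norm_le r.2.1 ?_
      ((by fun_prop : Continuous fun s : ℝ => L * (B * s ^ n)).intervalIntegrable _ _)
    refine Eventually.of_forall fun s hs => ?_
    have hs' : s ∈ Icc (0 : ℝ) 1 := ⟨hs.1.le, hs.2.trans r.2.2⟩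
    rw [extendPath, IccExtend_of_mem _ _ hs']
    exact (hT _ _).trans (mul_le_mul_of_nonneg_left (ih ⟨s, hs'⟩) hL)

theorem isUnit_one_sub_volterra_comp [CompleteSpace E]
    {T : C(Icc (0 : ℝ) 1, E) →L[ℂ] C(Icc (0 : ℝ) 1, E)} {L : ℝ}
    (hL : 0 ≤ L) (hT : ∀ h r, ‖T h r‖ ≤ L * ‖h r‖) : IsUnit (1 - volterra ∘L T) := by
  obtain ⟨n, hn⟩ := ((FloorSemiring.tendsto_pow_div_factorial_atTop L).eventually
    (gt_mem_nhds one_pos)).exists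
  have hnorm : ‖(volterra ∘L T) ^ n‖ < 1 := by
    refine lt_of_le_of_lt (ContinuousLinearMap.opNorm_le_bound _ (by positivity) fun h => ?_) hn
    refine (ContinuousMap.norm_le _ (by positivity)).2 fun r => ?_
    refine (norm_volterra_comp_pow_le hL hT n h r).trans ?_
    exact mul_le_of_le_one_right (by positivity) (pow_le_one₀ r.2.1 r.2.2)
  have hu := isUnit_one_sub_of_norm_lt_one
    (R := C(Icc (0 : ℝ) 1, E) →L[ℂ] C(Icc (0 : ℝ) 1, E)) hnorm
  rw [← mul_neg_geom_sum] at hu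
  refine ((Commute.isUnit_mul_iff ?_).1 hu).1
  rw [Commute, SemiconjBy, mul_neg_geom_sum, geom_sum_mul_neg]

end Volterra

/-! ### Holomorphic dependence of solutions on parameters -/

section LocalFlow

variable {P E : Type*} [NormedAddCommGroup P] [NormedSpace ℂ P]
  [NormedAddCommGroup E] [NormedSpace ℂ E]

/-- The path `r ↦ (π, c r)`, as a continuous linear function of `(π, c)`. -/
noncomputable def pairPath : P × C(Icc (0 : ℝ) 1, E) →L[ℂ] C(Icc (0 : ℝ) 1, P × E) :=
  ContinuousLinearMap.compLeftContinuous ℂ _ (.inl ℂ P E) ∘L ContinuousLinearMap.const ℂ _ ∘L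
    .fst ℂ P _ + ContinuousLinearMap.compLeftContinuous ℂ _ (.inr ℂ P E) ∘L .snd ℂ P _

@[simp]
theorem pairPath_apply (u : P × C(Icc (0 : ℝ) 1, E)) (r : Icc (0 : ℝ) 1) :
    pairPath u r = (u.1, u.2 r) := by
  simp [pairPath]

variable [CompleteSpace E]

theorem hasDerivWithinAt_of_eq_const_add_volterra {c h : C(Icc (0 : ℝ) 1, E)} {p : E}
    (hc : c = ContinuousMap.const _ p + volterra h) {r : ℝ} (hr : r ∈ Icc (0 : ℝ) 1) :
    HasDerivWithinAt (extendPath c) (h ⟨r, hr⟩) (Icc 0 1) r := by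
  refine ((hasDerivWithinAt_volterra h hr).const_add p).congr_of_mem (fun s hs => ?_) hr
  rw [hc, extendPath, IccExtend_of_mem _ _ hs, extendPath, IccExtend_of_mem _ _ hs]
  rfl

omit [CompleteSpace E] in
theorem apply_zero_of_eq_const_add_volterra {c h : C(Icc (0 : ℝ) 1, E)} {p : E}
    (hc : c = ContinuousMap.const _ p + volterra h) : c ⟨0, by simp⟩ = p := by
  rw [hc, ContinuousMap.add_apply, volterra_zero, add_zero, ContinuousMap.const_apply]

variable [CompleteSpace P]

/-- Holomorphic dependence of the solutions of `c' = f (π, c)` on `[0, 1]` on the parameter `π` and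
on the initial value, by the implicit function theorem in `C([0, 1], E)`: the linearization of the
integral equation is invertible since Volterra operators are quasi-nilpotent. -/
theorem exists_local_flow {f : P × E → E} {W : Set (P × E)} (hW : IsOpen W)
    (hf : DifferentiableOn ℂ f W) {c : ℝ → E} {π₀ : P}
    (hc : ∀ r ∈ Icc (0 : ℝ) 1,
      (π₀, c r) ∈ W ∧ HasDerivWithinAt c (f (π₀, c r)) (Icc 0 1) r) :
    ∃ Φ : P × E → C(Icc (0 : ℝ) 1, E), ContDiffAt ℂ 1 Φ (π₀, c 0) ∧
      (∀ r, Φ (π₀, c 0) r = c r) ∧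
      ∀ᶠ u in 𝓝 (π₀, c 0), (∀ r, (u.1, Φ u r) ∈ W) ∧
        Φ u = ContinuousMap.const _ u.2 + volterra (superpose f (pairPath (u.1, Φ u))) := by
  have hccont : ContinuousOn c (Icc 0 1) := fun r hr => (hc r hr).2.continuousWithinAt
  let c₀ : C(Icc (0 : ℝ) 1, E) := ⟨(Icc (0 : ℝ) 1).domRestrict c, hccont.domRestrict⟩
  have hc₀ : ∀ r, c₀ r = c r := fun r => rfl
  have hc₀W : ∀ r, pairPath (π₀, c₀) r ∈ W := fun r => by
    simpa [hc₀] using (hc r r.2).1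
  -- the integral equation `G = 0`
  let G : (P × E) × C(Icc (0 : ℝ) 1, E) → C(Icc (0 : ℝ) 1, E) := fun u =>
    u.2 - ContinuousLinearMap.const ℂ _ u.1.2 - volterra (superpose f (pairPath (u.1.1, u.2)))
  let J : (P × E) × C(Icc (0 : ℝ) 1, E) →L[ℂ] C(Icc (0 : ℝ) 1, P × E) :=
    pairPath ∘L ((ContinuousLinearMap.fst ℂ P E ∘L .fst ℂ _ _).prod (.snd ℂ _ _))
  have hJ : ∀ u, J u = pairPath (u.1.1, u.2) := fun u => rfl
  let O : Set ((P × E) × C(Icc (0 : ℝ) 1, E)) := J ⁻¹' {c | ∀ r, c r ∈ W}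
  have hO : IsOpen O := (isOpen_setOf_forall_mem hW).preimage J.continuous
  have hGderiv : ∀ u ∈ O, ∃ D : C(Icc (0 : ℝ) 1, P × E →L[ℂ] E),
      HasFDerivAt G (ContinuousLinearMap.snd ℂ _ _ -
        ContinuousLinearMap.const ℂ _ ∘L (ContinuousLinearMap.snd ℂ P E ∘L .fst ℂ _ _) -
        volterra ∘L pointwiseApply D ∘L J) u := by
    intro u hu
    obtain ⟨D, -, hD⟩ := exists_hasFDerivAt_superpose hW hf (c := J u) hu
    refine ⟨D, ?_⟩
    have h1 := (ContinuousLinearMap.const ℂ (Icc (0 : ℝ) 1) ∘L (ContinuousLinearMap.snd ℂ P E ∘L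
      .fst ℂ (P × E) C(Icc (0 : ℝ) 1, E))).hasFDerivAt (x := u)
    have h2 : HasFDerivAt (fun u => volterra (superpose f (J u)))
        (volterra ∘L pointwiseApply D ∘L J) u :=
      (volterra.hasFDerivAt (x := superpose f (J u))).comp u (hD.comp u J.hasFDerivAt)
    exact (hasFDerivAt_snd.sub h1).sub h2
  set u₀ : (P × E) × C(Icc (0 : ℝ) 1, E) := ((π₀, c 0), c₀) with hu₀
  have hu₀O : u₀ ∈ O := hc₀W
  have hG : ContDiffAt ℂ 1 G u₀ := contDiffAt_one_of_differentiableOn hO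
    (fun u hu => (hGderiv u hu).choose_spec.differentiableAt.differentiableWithinAt) hu₀O
  have hinv : (fderiv ℂ G u₀ ∘L .inr ℂ _ _).IsInvertible := by
    obtain ⟨D, hD⟩ := hGderiv u₀ hu₀O
    have hT : ∀ h r, ‖(pointwiseApply D ∘L J ∘L .inr ℂ (P × E) _) h r‖ ≤ ‖D‖ * ‖h r‖ := by
      intro h r
      have h1 : (pointwiseApply D ∘L J ∘L .inr ℂ (P × E) _) h r = D r (0, h r) := by
        simp [hJ]
      rw [h1]
      refine ((D r).le_of_opNorm_le (D.norm_coe_le_norm r) _).trans_eq ?_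
      simp
    obtain ⟨⟨a, b, hab, hba⟩, ha⟩ := isUnit_one_sub_volterra_comp (norm_nonneg D) hT
    have heq : fderiv ℂ G u₀ ∘L .inr ℂ _ _ = a := by
      rw [hD.fderiv]
      simp only at ha
      rw [ha]
      ext h r
      simp
    rw [heq]
    exact .of_inverse hab hba
  have hGu₀ : G u₀ = 0 := by
    ext r
    have hint := intervalIntegral.integral_eq_sub_of_hasDerivAt_of_le r.2.1
      (f := c) (f' := extendPath (superpose f (pairPath (π₀, c₀))))
      (hccont.mono (Icc_subset_Icc_right r.2.2)) (fun s hs => by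
        have hs' : s ∈ Icc (0 : ℝ) 1 := ⟨hs.1.le, hs.2.le.trans r.2.2⟩
        rw [extendPath, IccExtend_of_mem _ _ hs', superpose_apply hf.continuousOn hc₀W]
        simpa [hc₀] using (hc s hs').2.hasDerivAt (Icc_mem_nhds hs.1 (hs.2.trans_le r.2.2)))
      ((continuous_extendPath _).intervalIntegrable _ _)
    simp only [G, hu₀, ContinuousMap.sub_apply, volterra_apply, hint, hc₀]
    simp
  refine ⟨hG.implicitFunction one_ne_zero hinv, hG.contDiffAt_implicitFunction one_ne_zero hinv,
    fun r => ?_, ?_⟩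
  · have h0 := hG.implicitFunction_apply_self one_ne_zero hinv
    rw [show (π₀, c 0) = u₀.1 from rfl, h0]
    rfl
  · have h0 := hG.implicitFunction_apply_self one_ne_zero hinv
    have hcont := (hG.contDiffAt_implicitFunction one_ne_zero hinv).continuousAt
    have hOev : ∀ᶠ u in 𝓝 u₀.1, (u, hG.implicitFunction one_ne_zero hinv u) ∈ O := by
      refine (continuousAt_id.prodMk hcont).eventually_mem (hO.mem_nhds ?_)
      simpa [h0] using hu₀O
    filter_upwards [hG.eventually_apply_implicitFunction one_ne_zero hinv, hOev] with u hu huO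
    refine ⟨fun r => by simpa [hJ] using huO r, ?_⟩
    rw [hGu₀] at hu
    have := sub_eq_zero.1 ((sub_sub _ _ _).symm.trans hu)
    exact this

omit [CompleteSpace P] [CompleteSpace E] in
/-- The derivative of the flow with respect to the parameter and the initial value satisfies the
variational equation. -/
theorem fderiv_flow_eq {f : P × E → E} {W : Set (P × E)} (hW : IsOpen W)
    (hf : DifferentiableOn ℂ f W) {Φ : P × E → C(Icc (0 : ℝ) 1, E)} {u₀ : P × E}
    (hΦ : ContDiffAt ℂ 1 Φ u₀)
    (hsol : ∀ᶠ u in 𝓝 u₀, (∀ r, (u.1, Φ u r) ∈ W) ∧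
        Φ u = ContinuousMap.const _ u.2 + volterra (superpose f (pairPath (u.1, Φ u))))
    (w : P × E) : ∃ D : C(Icc (0 : ℝ) 1, P × E →L[ℂ] E),
      (∀ r, D r = fderiv ℂ f (u₀.1, Φ u₀ r)) ∧
      fderiv ℂ Φ u₀ w = ContinuousMap.const _ w.2 +
        volterra (pointwiseApply D (pairPath (w.1, fderiv ℂ Φ u₀ w))) := by
  have hmem : ∀ r, pairPath (u₀.1, Φ u₀) r ∈ W := by simpa using hsol.self_of_nhds.1
  obtain ⟨D, hD, hDd⟩ := exists_hasFDerivAt_superpose hW hf hmem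
  refine ⟨D, by simpa using hD, ?_⟩
  have hd := (hΦ.differentiableAt one_ne_zero).hasFDerivAt
  have hinner : HasFDerivAt (fun u => (pairPath (u.1, Φ u) : C(Icc (0 : ℝ) 1, P × E)))
      (pairPath ∘L (ContinuousLinearMap.fst ℂ P E).prod (fderiv ℂ Φ u₀)) u₀ :=
    ((pairPath (P := P) (E := E)).hasFDerivAt (x := (u₀.1, Φ u₀))).comp u₀
      (hasFDerivAt_fst.prodMk hd)
  have hrhs : HasFDerivAt (fun u : P × E => ContinuousLinearMap.const ℂ (Icc (0 : ℝ) 1) u.2 +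
      volterra (superpose f (pairPath (u.1, Φ u))))
      (ContinuousLinearMap.const ℂ _ ∘L .snd ℂ P E + volterra ∘L pointwiseApply D ∘L pairPath ∘L
        (ContinuousLinearMap.fst ℂ P E).prod (fderiv ℂ Φ u₀)) u₀ := by
    have h1 := (ContinuousLinearMap.const ℂ (Icc (0 : ℝ) 1) ∘L
      ContinuousLinearMap.snd ℂ P E).hasFDerivAt (x := u₀)
    have h2 := (volterra.hasFDerivAt (x := superpose f (pairPath (u₀.1, Φ u₀)))).comp u₀
      (HasFDerivAt.comp u₀ hDd hinner)
    exact h1.add h2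
  have heq := hd.unique (hrhs.congr_of_eventuallyEq (hsol.mono fun u hu => hu.2))
  have := congrArg (fun L => L w) heq
  exact this

end LocalFlow

/-! ### The complex-time flow -/

section FlowRelation

variable {X : ℂ × ℂ → ℂ × ℂ} {U : Set (ℂ × ℂ)} {t : ℂ} {p q q' : ℂ × ℂ}

theorem FlowEq.mem_left (h : FlowEq X U t p q) : p ∈ U := by
  obtain ⟨c, rfl, -, hc⟩ := h
  exact (hc 0 (by simp)).1

theorem FlowEq.mem_right (h : FlowEq X U t p q) : q ∈ U := by
  obtain ⟨c, -, rfl, hc⟩ := h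
  exact (hc 1 (by simp)).1

theorem flowEq_of_eq_zero (hp : p ∈ U) (hX : X p = 0) : FlowEq X U t p p :=
  ⟨fun _ => p, rfl, rfl, fun r _ => ⟨hp, by
    rw [hX, smul_zero]; exact hasDerivWithinAt_const r (Icc 0 1) p⟩⟩

/-- Backward flow. -/
theorem FlowEq.symm (h : FlowEq X U t p q) : FlowEq X U (-t) q p := by
  obtain ⟨c, rfl, rfl, hc⟩ := h
  refine ⟨fun r => c (1 - r), by simp, by simp, fun r hr => ?_⟩
  have hr' : 1 - r ∈ Icc (0 : ℝ) 1 := ⟨by linarith [hr.2], by linarith [hr.1]⟩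
  refine ⟨(hc _ hr').1, ?_⟩
  have h1 : HasDerivWithinAt (fun r : ℝ => 1 - r) (-1) (Icc 0 1) r :=
    ((hasDerivAt_id r).const_sub 1).hasDerivWithinAt
  have h2 := (hc _ hr').2.scomp r h1 (fun s hs => ⟨by linarith [hs.2], by linarith [hs.1]⟩)
  simp only [neg_smul, one_smul] at h2 ⊢
  exact h2

/-- A solution of `y' = a X(y)` in a complex variable realizes the flow along segments. -/
theorem flowEq_of_hasDerivAt {y : ℂ → ℂ × ℂ} {a θ₀ θ : ℂ}
    (hy : ∀ r ∈ Icc (0 : ℝ) 1, y (θ₀ + r * θ) ∈ U ∧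
      HasDerivAt y (a • X (y (θ₀ + r * θ))) (θ₀ + r * θ)) :
    FlowEq X U (a * θ) (y θ₀) (y (θ₀ + θ)) := by
  refine ⟨fun r => y (θ₀ + r * θ), by simp, by simp, fun r hr => ⟨(hy r hr).1, ?_⟩⟩
  have h1 : HasDerivAt (fun r : ℝ => θ₀ + r * θ) θ r := by
    simpa using ((hasDerivAt_id r).ofReal_comp.mul_const θ).const_add θ₀
  have h2 := (hy r hr).2.scomp r h1
  rw [smul_smul, mul_comm] at h2
  exact h2.hasDerivWithinAt

/-- An integral curve in real time realizes the flow. -/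
theorem flowEq_of_integralCurve {γ : ℝ → ℂ × ℂ} (hγ : ∀ t, HasDerivAt γ (X (γ t)) t)
    (hU : ∀ t, γ t ∈ U) (a b : ℝ) : FlowEq X U ((b - a : ℝ) : ℂ) (γ a) (γ b) := by
  refine ⟨fun r => γ (a + r * (b - a)), by simp, by simp, fun r _ => ⟨hU _, ?_⟩⟩
  have h1 : HasDerivAt (fun r : ℝ => a + r * (b - a)) (b - a) r := by
    simpa using ((hasDerivAt_id r).mul_const (b - a)).const_add a
  have h2 := (hγ (a + r * (b - a))).scomp r h1
  rw [Complex.coe_smul]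
  exact h2.hasDerivWithinAt

theorem eqOn_of_flow (hU : IsOpen U) (hX : DifferentiableOn ℂ X U) {c d : ℝ → ℂ × ℂ}
    (hc : ∀ r ∈ Icc (0 : ℝ) 1, c r ∈ U ∧ HasDerivWithinAt c (t • X (c r)) (Icc (0 : ℝ) 1) r)
    (hd : ∀ r ∈ Icc (0 : ℝ) 1, d r ∈ U ∧ HasDerivWithinAt d (t • X (d r)) (Icc (0 : ℝ) 1) r)
    (h0 : c 0 = d 0) : EqOn c d (Icc 0 1) := by
  have hcc : ContinuousOn c (Icc 0 1) := fun r hr => (hc r hr).2.continuousWithinAt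
  have hdc : ContinuousOn d (Icc 0 1) := fun r hr => (hd r hr).2.continuousWithinAt
  -- the field is Lipschitz on the union of the two trajectories, which is compact
  let K : Set (ℂ × ℂ) := c '' Icc 0 1 ∪ d '' Icc 0 1
  have hK : IsCompact K := (isCompact_Icc.image_of_continuousOn hcc).union
    (isCompact_Icc.image_of_continuousOn hdc)
  have hKU : K ⊆ U := by
    rintro _ (⟨r, hr, rfl⟩ | ⟨r, hr, rfl⟩)
    exacts [(hc r hr).1, (hd r hr).1]
  obtain ⟨L, hL⟩ := LocallyLipschitzOn.exists_lipschitzOnWith_of_compact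
    (f := fun x => t • X x) hK (fun x hx => by
      obtain ⟨L, s, hs, hLs⟩ := (contDiffAt_one_of_differentiableOn hU
        (hX.const_smul t) (hKU hx)).exists_lipschitzOnWith
      exact ⟨L, s, mem_nhdsWithin_of_mem_nhds hs, hLs⟩)
  have hder : ∀ {c : ℝ → ℂ × ℂ} {r : ℝ} {v : ℂ × ℂ}, r ∈ Ico (0 : ℝ) 1 →
      HasDerivWithinAt c v (Icc 0 1) r → HasDerivWithinAt c v (Ici r) r := fun hr h =>
    h.mono_of_mem_nhdsWithin (mem_of_superset (Icc_mem_nhdsGE hr.2) (Icc_subset_Icc_left hr.1))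
  exact ODE_solution_unique_of_mem_Icc_right (v := fun _ x => t • X x) (s := fun _ => K)
    (fun _ _ => hL) hcc
    (fun r hr => hder hr (hc r (Ico_subset_Icc_self hr)).2)
    (fun r hr => Or.inl ⟨r, Ico_subset_Icc_self hr, rfl⟩) hdc
    (fun r hr => hder hr (hd r (Ico_subset_Icc_self hr)).2)
    (fun r hr => Or.inr ⟨r, Ico_subset_Icc_self hr, rfl⟩) h0

theorem FlowEq.unique (hU : IsOpen U) (hX : DifferentiableOn ℂ X U) (h : FlowEq X U t p q)
    (h' : FlowEq X U t p q') : q = q' := by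
  obtain ⟨c, rfl, rfl, hc⟩ := h
  obtain ⟨d, hd0, rfl, hd⟩ := h'
  exact eqOn_of_flow hU hX hc hd hd0.symm (by simp)

/-- A trajectory does not reach a singular point. -/
theorem FlowEq.ne_zero (hU : IsOpen U) (hX : DifferentiableOn ℂ X U) (h : FlowEq X U t p q)
    (hp : X p ≠ 0) : X q ≠ 0 := fun hq =>
  hp (h.symm.unique hU hX (flowEq_of_eq_zero h.mem_right hq) ▸ hq)

theorem FlowEq.ray {c : ℝ → ℂ × ℂ} (h0 : c 0 = p)
    (hc : ∀ r ∈ Icc (0 : ℝ) 1, c r ∈ U ∧ HasDerivWithinAt c (t • X (c r)) (Icc (0 : ℝ) 1) r)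
    {s : ℝ} (hs : s ∈ Icc (0 : ℝ) 1) : FlowEq X U (s * t) p (c s) := by
  refine ⟨fun r => c (s * r), by simpa, by simp, fun r hr => ?_⟩
  have hmaps : ∀ r ∈ Icc (0 : ℝ) 1, s * r ∈ Icc (0 : ℝ) 1 := fun r hr =>
    ⟨mul_nonneg hs.1 hr.1, mul_le_one₀ hs.2 hr.1 hr.2⟩
  refine ⟨(hc _ (hmaps r hr)).1, ?_⟩
  have h1 : HasDerivWithinAt (fun r : ℝ => s * r) s (Icc 0 1) r := by
    simpa using ((hasDerivAt_id r).const_mul s).hasDerivWithinAt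
  have h2 := (hc _ (hmaps r hr)).2.scomp r h1 hmaps
  rw [mul_smul, Complex.coe_smul]
  exact h2

/-- The flow map `φ^t_X` on `U`, with junk values where the flow is not defined. -/
noncomputable def flowMap (X : ℂ × ℂ → ℂ × ℂ) (U : Set (ℂ × ℂ)) (t : ℂ) (p : ℂ × ℂ) : ℂ × ℂ :=
  Classical.epsilon fun q => FlowEq X U t p q

theorem FlowEq.flowEq_flowMap (h : FlowEq X U t p q) : FlowEq X U t p (flowMap X U t p) :=
  Classical.epsilon_spec (p := fun q => FlowEq X U t p q) ⟨q, h⟩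

theorem FlowEq.flowMap_eq (hU : IsOpen U) (hX : DifferentiableOn ℂ X U) (h : FlowEq X U t p q) :
    flowMap X U t p = q :=
  h.flowEq_flowMap.unique hU hX h

end FlowRelation

section FlowFamily

variable {Q : Type*} [NormedAddCommGroup Q] [NormedSpace ℂ Q]
  {Y : Q → ℂ × ℂ → ℂ × ℂ} {B : Set Q} {U : Set (ℂ × ℂ)}

theorem differentiableOn_section (hY : DifferentiableOn ℂ (fun z : Q × (ℂ × ℂ) => Y z.1 z.2)
    (B ×ˢ U)) {q : Q} (hq : q ∈ B) : DifferentiableOn ℂ (Y q) U := by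
  have : DifferentiableOn ℂ (fun x : ℂ × ℂ => (q, x)) U := by fun_prop
  exact hY.comp this fun x hx => ⟨hq, hx⟩

variable [CompleteSpace Q]

/-- The flow of a holomorphic family of vector fields is defined on an open set of parameters,
times and initial points, and it is holomorphic there. Its derivative in the initial point is given
by the variational equation along the trajectory `c`. -/
theorem flow_family_regularity (hB : IsOpen B) (hU : IsOpen U)
    (hY : DifferentiableOn ℂ (fun z : Q × (ℂ × ℂ) => Y z.1 z.2) (B ×ˢ U))
    {q₀ : Q} (hq₀ : q₀ ∈ B) {T₀ : ℂ} {c : ℝ → ℂ × ℂ}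
    (hc : ∀ r ∈ Icc (0 : ℝ) 1,
      c r ∈ U ∧ HasDerivWithinAt c (T₀ • Y q₀ (c r)) (Icc (0 : ℝ) 1) r) :
    (∀ᶠ z : (Q × ℂ) × (ℂ × ℂ) in 𝓝 ((q₀, T₀), c 0),
      FlowEq (Y z.1.1) U z.1.2 z.2 (flowMap (Y z.1.1) U z.1.2 z.2)) ∧
    ContDiffAt ℂ 1 (fun z : (Q × ℂ) × (ℂ × ℂ) => flowMap (Y z.1.1) U z.1.2 z.2)
      ((q₀, T₀), c 0) ∧
    ∀ w : ℂ × ℂ, ∃ v : ℝ → ℂ × ℂ, v 0 = w ∧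
      v 1 = fderiv ℂ (fun z : (Q × ℂ) × (ℂ × ℂ) => flowMap (Y z.1.1) U z.1.2 z.2)
        ((q₀, T₀), c 0) ((0, 0), w) ∧
      ∀ r ∈ Icc (0 : ℝ) 1,
        HasDerivWithinAt v (T₀ • fderiv ℂ (Y q₀) (c r) (v r)) (Icc (0 : ℝ) 1) r := by
  let f : (Q × ℂ) × (ℂ × ℂ) → ℂ × ℂ := fun z => z.1.2 • Y z.1.1 z.2
  let π : (Q × ℂ) × (ℂ × ℂ) → Q × (ℂ × ℂ) := fun z => (z.1.1, z.2)
  have hπ : Differentiable ℂ π := by fun_prop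
  let W : Set ((Q × ℂ) × (ℂ × ℂ)) := π ⁻¹' (B ×ˢ U)
  have hW : IsOpen W := (hB.prod hU).preimage hπ.continuous
  have hf : DifferentiableOn ℂ f W := by
    have h1 : DifferentiableOn ℂ (fun z => Y (π z).1 (π z).2) W :=
      hY.comp hπ.differentiableOn fun z hz => hz
    have h2 : DifferentiableOn ℂ (fun z : (Q × ℂ) × (ℂ × ℂ) => z.1.2) W := by fun_prop
    exact h2.smul h1
  obtain ⟨Φ, hΦ, hΦ₀, hsol⟩ := exists_local_flow hW hf (c := c) (π₀ := (q₀, T₀))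
    fun r hr => ⟨⟨hq₀, (hc r hr).1⟩, (hc r hr).2⟩
  have hflow : ∀ᶠ z : (Q × ℂ) × (ℂ × ℂ) in 𝓝 ((q₀, T₀), c 0), z.1.1 ∈ B ∧
      FlowEq (Y z.1.1) U z.1.2 z.2 (Φ z ⟨1, by simp⟩) := by
    filter_upwards [hsol] with z hz
    obtain ⟨hzW, hz⟩ := hz
    refine ⟨(hzW ⟨0, by simp⟩).1, extendPath (Φ z), ?_, ?_, fun r hr => ⟨?_, ?_⟩⟩
    · rw [extendPath, IccExtend_of_mem _ _ (by simp)]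
      exact apply_zero_of_eq_const_add_volterra hz
    · rw [extendPath, IccExtend_of_mem _ _ (by simp)]
    · rw [extendPath, IccExtend_of_mem _ _ hr]
      exact (hzW _).2
    · have := hasDerivWithinAt_of_eq_const_add_volterra hz hr
      rw [superpose_apply hf.continuousOn (by simpa using hzW)] at this
      rw [extendPath, IccExtend_of_mem _ _ hr]
      simpa [f] using this
  have hev : (fun z : (Q × ℂ) × (ℂ × ℂ) => flowMap (Y z.1.1) U z.1.2 z.2)
      =ᶠ[𝓝 ((q₀, T₀), c 0)] fun z => Φ z ⟨1, by simp⟩ :=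
    hflow.mono fun z hz => hz.2.flowMap_eq hU (differentiableOn_section hY hz.1)
  let ev : C(Icc (0 : ℝ) 1, ℂ × ℂ) →L[ℂ] ℂ × ℂ := ContinuousMap.evalCLM ℂ ⟨1, by simp⟩
  refine ⟨hflow.mono fun z hz => hz.2.flowEq_flowMap, ?_, fun w => ?_⟩
  · exact (ev.contDiff.contDiffAt.comp _ hΦ).congr_of_eventuallyEq hev
  · obtain ⟨D, hD, hvar⟩ := fderiv_flow_eq hW hf hΦ hsol ((0, 0), w)
    set v := fderiv ℂ Φ ((q₀, T₀), c 0) ((0, 0), w) with hv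
    refine ⟨extendPath v, ?_, ?_, fun r hr => ?_⟩
    · rw [extendPath, IccExtend_of_mem _ _ (by simp)]
      exact apply_zero_of_eq_const_add_volterra hvar
    · rw [extendPath, IccExtend_of_mem _ _ (by simp), hev.fderiv_eq]
      have := (ev.hasFDerivAt.comp _ (hΦ.differentiableAt one_ne_zero).hasFDerivAt).fderiv
      exact (congrArg (fun L => L ((0, 0), w)) this).symm
    · have h1 := hasDerivWithinAt_of_eq_const_add_volterra hvar hr
      have h2 : pointwiseApply D (pairPath (((0, 0), w).1, v)) ⟨r, hr⟩ =
          T₀ • fderiv ℂ (Y q₀) (c r) (extendPath v r) := by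
        rw [extendPath, IccExtend_of_mem _ _ hr]
        simp only [pointwiseApply_apply, pairPath_apply, hD, hΦ₀]
        have h3 : HasFDerivAt (fun x : ℂ × ℂ => f ((q₀, T₀), x))
            (fderiv ℂ f ((q₀, T₀), c r) ∘L .inr ℂ _ _) (c r) :=
          (hf.differentiableAt (hW.mem_nhds ⟨hq₀, (hc r hr).1⟩)).hasFDerivAt.comp (c r)
            (hasFDerivAt_prodMk_right _ _)
        have h4 : HasFDerivAt (fun x : ℂ × ℂ => f ((q₀, T₀), x))
            (T₀ • fderiv ℂ (Y q₀) (c r)) (c r) :=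
          (((differentiableOn_section hY hq₀).differentiableAt
            (hU.mem_nhds (hc r hr).1)).hasFDerivAt).const_smul T₀
        have h5 := congrArg (fun L => L (v ⟨r, hr⟩)) (h3.unique h4)
        exact h5
      rw [h2] at h1
      exact h1

theorem eventually_flowEq_flowMap (hB : IsOpen B) (hU : IsOpen U)
    (hY : DifferentiableOn ℂ (fun z : Q × (ℂ × ℂ) => Y z.1 z.2) (B ×ˢ U))
    {q : Q} (hq : q ∈ B) {T : ℂ} {p y : ℂ × ℂ} (h : FlowEq (Y q) U T p y) :
    ∀ᶠ z : (Q × ℂ) × (ℂ × ℂ) in 𝓝 ((q, T), p),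
      FlowEq (Y z.1.1) U z.1.2 z.2 (flowMap (Y z.1.1) U z.1.2 z.2) := by
  obtain ⟨c, rfl, -, hc⟩ := h
  exact (flow_family_regularity hB hU hY hq hc).1

theorem contDiffAt_flowMap (hB : IsOpen B) (hU : IsOpen U)
    (hY : DifferentiableOn ℂ (fun z : Q × (ℂ × ℂ) => Y z.1 z.2) (B ×ˢ U))
    {q : Q} (hq : q ∈ B) {T : ℂ} {p y : ℂ × ℂ} (h : FlowEq (Y q) U T p y) :
    ContDiffAt ℂ 1 (fun z : (Q × ℂ) × (ℂ × ℂ) => flowMap (Y z.1.1) U z.1.2 z.2)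
      ((q, T), p) := by
  obtain ⟨c, rfl, -, hc⟩ := h
  exact (flow_family_regularity hB hU hY hq hc).2.1

end FlowFamily

/-- The flow map solves the differential equation in complex time: its complex derivative, which
is known to exist, is computed along a segment of times starting at `0`. -/
theorem hasDerivAt_flowMap {X : ℂ × ℂ → ℂ × ℂ} {U : Set (ℂ × ℂ)} (hU : IsOpen U)
    (hX : DifferentiableOn ℂ X U) {T : ℂ} {p y : ℂ × ℂ} (h : FlowEq X U T p y) :
    HasDerivAt (fun T => flowMap X U T p) (X y) T := by
  -- the constant family of vector fields equal to `X`
  have hY : DifferentiableOn ℂ (fun z : ℂ × (ℂ × ℂ) => (fun _ => X) z.1 z.2)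
      ((univ : Set ℂ) ×ˢ U) := hX.comp differentiableOn_snd fun z hz => hz.2
  have hd : DifferentiableAt ℂ (fun T => flowMap X U T p) T :=
    ((contDiffAt_flowMap (Y := fun _ : ℂ => X) isOpen_univ hU hY (mem_univ (0 : ℂ))
      h).differentiableAt one_ne_zero).comp T
      (f := fun T : ℂ => (((0 : ℂ), T), p)) (by fun_prop)
  have key : ∀ {T₁ : ℂ} {c : ℝ → ℂ × ℂ} {s : ℝ}, T₁ ≠ 0 → s ∈ Icc (0 : ℝ) 1 → c 0 = p →
      (∀ r ∈ Icc (0 : ℝ) 1,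
        c r ∈ U ∧ HasDerivWithinAt c (T₁ • X (c r)) (Icc (0 : ℝ) 1) r) → T = s * T₁ →
      c s = y → HasDerivAt (fun T => flowMap X U T p) (X y) T := by
    rintro T₁ c s hT₁ hs h0 hc rfl rfl
    have h1 : HasDerivAt (fun r : ℝ => (r : ℂ) * T₁) T₁ s := by
      simpa using ((hasDerivAt_id s).ofReal_comp.mul_const T₁)
    have h2 := (hd.hasDerivAt.scomp s h1).hasDerivWithinAt (s := Icc 0 1)
    have h3 := (hc s hs).2.congr_of_mem (f₁ := fun r : ℝ => flowMap X U (r * T₁) p)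
      (fun r hr => (FlowEq.ray h0 hc hr).flowMap_eq hU hX) hs
    have h4 := (uniqueDiffOn_Icc zero_lt_one s hs).eq_deriv _ h3 h2
    rw [smul_right_injective _ hT₁ h4]
    exact hd.hasDerivAt
  obtain ⟨c, h0, h1, hc⟩ := id h
  rcases eq_or_ne T 0 with rfl | hT
  · have hpy : y = p := h.unique hU hX ⟨fun _ => p, rfl, rfl, fun r _ => ⟨h.mem_left, by
      rw [zero_smul]; exact hasDerivWithinAt_const r (Icc 0 1) p⟩⟩
    -- at the time `0`, the segment runs to a nearby time `T₁ ≠ 0`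
    have hev : ∀ᶠ T₁ : ℂ in 𝓝[≠] 0, FlowEq X U T₁ p (flowMap X U T₁ p) := by
      have ht : Tendsto (fun T₁ : ℂ => (((0 : ℂ), T₁), p)) (𝓝 0) (𝓝 ((0, 0), p)) :=
        Continuous.tendsto (by fun_prop) 0
      exact nhdsWithin_le_nhds (ht.eventually (eventually_flowEq_flowMap (Y := fun _ : ℂ => X)
        isOpen_univ hU hY (mem_univ (0 : ℂ)) h))
    obtain ⟨T₁, ⟨d, hd0, -, hd⟩, hT₁⟩ := (hev.and self_mem_nhdsWithin).exists
    exact key (s := 0) hT₁ (by simp) hd0 hd (by simp) (hd0.trans hpy.symm)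
  · exact key (s := 1) hT (by simp) h0 hc (by simp) h1

/-! ### Nondegeneracy and continuation of periodic orbits -/

section Nondegeneracy

/-- The determinant of two vectors of `ℂ²`. -/
def det₂ (u v : ℂ × ℂ) : ℂ := u.1 * v.2 - u.2 * v.1

theorem det₂_map_add_map (D : ℂ × ℂ →L[ℂ] ℂ × ℂ) (u v : ℂ × ℂ) :
    det₂ (D u) v + det₂ u (D v) = ((D (1, 0)).1 + (D (0, 1)).2) * det₂ u v := by
  have h : ∀ u : ℂ × ℂ, D u = u.1 • D (1, 0) + u.2 • D (0, 1) := fun u => by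
    rw [← map_smul, ← map_smul, ← map_add]
    simp
  rw [h u, h v]
  simp only [det₂, Prod.fst_add, Prod.snd_add, Prod.smul_fst, Prod.smul_snd, smul_eq_mul]
  ring

theorem det₂_ne_zero_of_isCompl {u v : ℂ × ℂ}
    (h : IsCompl (Submodule.span ℂ {u}) (Submodule.span ℂ {v})) : det₂ v u ≠ 0 := by
  have hspan : ∀ w : ℂ × ℂ, ∃ a b : ℂ, a • u + b • v = w := fun w => by
    rw [← Submodule.mem_span_pair, Submodule.span_insert, h.sup_eq_top]
    trivial
  obtain ⟨a, b, hab⟩ := hspan (1, 0)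
  obtain ⟨a', b', hab'⟩ := hspan (0, 1)
  intro h0
  simp only [Prod.ext_iff, Prod.fst_add, Prod.snd_add, Prod.smul_fst, Prod.smul_snd,
    smul_eq_mul] at hab hab'
  have h1 : det₂ (a • u + b • v) (a' • u + b' • v) = (b * a' - a * b') * det₂ v u := by
    simp only [det₂, Prod.fst_add, Prod.snd_add, Prod.smul_fst, Prod.smul_snd, smul_eq_mul]
    ring
  rw [h0, mul_zero] at h1
  simp only [det₂, Prod.fst_add, Prod.snd_add, Prod.smul_fst, Prod.smul_snd,
    smul_eq_mul, hab.1, hab.2, hab'.1, hab'.2] at h1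
  norm_num at h1

variable {X : ℂ × ℂ → ℂ × ℂ} {U : Set (ℂ × ℂ)} {T κ : ℂ}

/-- Liouville's formula: along a trajectory of a field of constant divergence `κ`, the area spanned
by the field and by a solution of the variational equation is multiplied by `exp (T κ)`. -/
theorem det₂_variational_eq (hU : IsOpen U) (hX : DifferentiableOn ℂ X U)
    (hdiv : ∀ x ∈ U, divergence X x = κ) {c v : ℝ → ℂ × ℂ}
    (hc : ∀ r ∈ Icc (0 : ℝ) 1, c r ∈ U ∧ HasDerivWithinAt c (T • X (c r)) (Icc (0 : ℝ) 1) r)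
    (hv : ∀ r ∈ Icc (0 : ℝ) 1,
      HasDerivWithinAt v (T • fderiv ℂ X (c r) (v r)) (Icc (0 : ℝ) 1) r) :
    det₂ (X (c 1)) (v 1) = Complex.exp (T * κ) * det₂ (X (c 0)) (v 0) := by
  let φ : ℝ → ℂ := fun r => Complex.exp (-(r * (T * κ))) * det₂ (X (c r)) (v r)
  have hφ : ∀ r ∈ Icc (0 : ℝ) 1, HasDerivWithinAt φ 0 (Icc (0 : ℝ) 1) r := by
    intro r hr
    have h1 : HasDerivWithinAt (fun r => X (c r)) (fderiv ℂ X (c r) (T • X (c r)))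
        (Icc (0 : ℝ) 1) r :=
      ((hX.differentiableAt (hU.mem_nhds (hc r hr).1)).hasFDerivAt.restrictScalars
        ℝ).comp_hasDerivWithinAt r (hc r hr).2
    have h2 := hv r hr
    have hexp : HasDerivWithinAt (fun r : ℝ => Complex.exp (-(r * (T * κ))))
        (Complex.exp (-(r * (T * κ))) * -(T * κ)) (Icc (0 : ℝ) 1) r := by
      have := ((hasDerivAt_id r).ofReal_comp.mul_const (T * κ)).neg.cexp
      simpa using this.hasDerivWithinAt
    have hfst : ∀ {w : ℝ → ℂ × ℂ} {w' : ℂ × ℂ}, HasDerivWithinAt w w' (Icc (0 : ℝ) 1) r →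
        HasDerivWithinAt (fun r => (w r).1) w'.1 (Icc (0 : ℝ) 1) r := fun h =>
      (ContinuousLinearMap.fst ℝ ℂ ℂ).hasFDerivAt.comp_hasDerivWithinAt r h
    have hsnd : ∀ {w : ℝ → ℂ × ℂ} {w' : ℂ × ℂ}, HasDerivWithinAt w w' (Icc (0 : ℝ) 1) r →
        HasDerivWithinAt (fun r => (w r).2) w'.2 (Icc (0 : ℝ) 1) r := fun h =>
      (ContinuousLinearMap.snd ℝ ℂ ℂ).hasFDerivAt.comp_hasDerivWithinAt r h
    have h3 := hexp.mul (((hfst h1).mul (hsnd h2)).sub ((hsnd h1).mul (hfst h2)))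
    refine h3.congr_deriv ?_
    have h4 := det₂_map_add_map (fderiv ℂ X (c r)) (X (c r)) (v r)
    have h5 := hdiv _ (hc r hr).1
    rw [divergence] at h5
    rw [h5] at h4
    simp only [det₂, map_smul, Prod.smul_fst, Prod.smul_snd, smul_eq_mul, Pi.sub_apply,
      Pi.mul_apply] at h4 ⊢
    linear_combination Complex.exp (-(r * (T * κ))) * T * h4
  have hconst := constant_of_has_deriv_right_zero (f := φ) (a := 0) (b := 1)
    (fun r hr => (hφ r hr).continuousWithinAt)
    (fun r hr => (hφ r (Ico_subset_Icc_self hr)).mono_of_mem_nhdsWithin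
      (mem_of_superset (Icc_mem_nhdsGE hr.2) (Icc_subset_Icc_left hr.1))) 1 (by simp)
  simp only [φ, Complex.ofReal_one, one_mul, Complex.ofReal_zero, zero_mul, Complex.exp_neg,
    Complex.exp_zero, inv_one] at hconst
  rw [← hconst, mul_inv_cancel_left₀ (Complex.exp_ne_zero _)]

end Nondegeneracy

section Continuation

variable {Q : Type*} [NormedAddCommGroup Q] [NormedSpace ℂ Q] [CompleteSpace Q]
  {Y : Q → ℂ × ℂ → ℂ × ℂ} {B : Set Q} {U : Set (ℂ × ℂ)}

theorem isInvertible_of_injective {A : ℂ × ℂ →L[ℂ] ℂ × ℂ} (h : Function.Injective A) :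
    A.IsInvertible := by
  have hs : Function.Surjective A :=
    LinearMap.injective_iff_surjective (f := (A : ℂ × ℂ →ₗ[ℂ] ℂ × ℂ)).1 h
  exact ⟨ContinuousLinearEquiv.ofBijective A (LinearMap.ker_eq_bot.2 h)
    (LinearMap.range_eq_top.2 hs), ContinuousLinearEquiv.coe_ofBijective A _ _⟩

/-- Continuation of a periodic orbit. In a holomorphic family of vector fields, a periodic orbit
through `p` of complex frequency `g₀` of a field of constant divergence `κ` with
`exp (κ / g₀) ≠ 1` persists, with a frequency and an intersection point with the transversal
`p + ℂ e` that are unique and holomorphic in the parameter: by Liouville's formula `1` is a simple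
eigenvalue of the monodromy. -/
theorem exists_periodic_continuation (hB : IsOpen B) (hU : IsOpen U)
    (hY : DifferentiableOn ℂ (fun z : Q × (ℂ × ℂ) => Y z.1 z.2) (B ×ˢ U))
    {q₀ : Q} (hq₀ : q₀ ∈ B) {g₀ κ : ℂ} (hg₀ : g₀ ≠ 0) {p e : ℂ × ℂ}
    (hper : FlowEq (Y q₀) U (1 / g₀) p p) (hdiv : ∀ x ∈ U, divergence (Y q₀) x = κ)
    (hκ : Complex.exp (1 / g₀ * κ) ≠ 1) (he : det₂ (Y q₀ p) e ≠ 0) :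
    ∃ G : Q → ℂ × ℂ, G q₀ = (g₀, 0) ∧ ContDiffAt ℂ 1 G q₀ ∧
      (∀ᶠ q in 𝓝 q₀, FlowEq (Y q) U (1 / (G q).1) (p + (G q).2 • e) (p + (G q).2 • e)) ∧
      ∀ᶠ u in 𝓝 (q₀, (g₀, (0 : ℂ))),
        FlowEq (Y u.1) U (1 / u.2.1) (p + u.2.2 • e) (p + u.2.2 • e) → u.2 = G u.1 := by
  have hX := differentiableOn_section hY hq₀
  let Ft : (Q × ℂ) × (ℂ × ℂ) → ℂ × ℂ := fun z => flowMap (Y z.1.1) U z.1.2 z.2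
  let J : Q × (ℂ × ℂ) → (Q × ℂ) × (ℂ × ℂ) := fun u => ((u.1, 1 / u.2.1), p + u.2.2 • e)
  let F : Q × (ℂ × ℂ) → ℂ × ℂ := fun u => Ft (J u) - (p + u.2.2 • e)
  set u₀ : Q × (ℂ × ℂ) := (q₀, (g₀, 0)) with hu₀
  have hJ₀ : J u₀ = ((q₀, 1 / g₀), p) := by simp [J, hu₀]
  have hJd : ContDiffAt ℂ 1 J u₀ := by
    have h1 : ContDiffAt ℂ 1 (fun u : Q × (ℂ × ℂ) => 1 / u.2.1) u₀ :=
      contDiffAt_const.div (by fun_prop) hg₀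
    have h2 : ContDiffAt ℂ 1 (fun u : Q × (ℂ × ℂ) => p + u.2.2 • e) u₀ := by fun_prop
    exact (contDiffAt_fst.prodMk h1).prodMk h2
  have hFt : ContDiffAt ℂ 1 Ft (J u₀) := hJ₀ ▸ contDiffAt_flowMap hB hU hY hq₀ hper
  have hF : ContDiffAt ℂ 1 F u₀ :=
    (hFt.comp u₀ hJd).sub (by fun_prop)
  have hF₀ : F u₀ = 0 := by
    simp only [F, hJ₀, Ft, hper.flowMap_eq hU hX]
    simp [hu₀]
  have hFd := (hF.differentiableAt one_ne_zero).hasFDerivAt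
  have hFtd := (hFt.differentiableAt one_ne_zero).hasFDerivAt
  -- the derivative with respect to the frequency
  have hA₁ : fderiv ℂ F u₀ (0, (1, 0)) = (-(1 / g₀ ^ 2)) • Y q₀ p := by
    have h1 : HasDerivAt (fun g : ℂ => ((q₀, (g, 0)) : Q × (ℂ × ℂ))) (0, (1, 0)) g₀ :=
      (hasDerivAt_const g₀ q₀).prodMk ((hasDerivAt_id g₀).prodMk (hasDerivAt_const g₀ 0))
    have h2 : HasDerivAt (fun g : ℂ => F (q₀, (g, 0))) (fderiv ℂ F u₀ (0, (1, 0))) g₀ :=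
      hFd.comp_hasDerivAt g₀ h1
    have h3 : HasDerivAt (fun g : ℂ => 1 / g) (-(1 / g₀ ^ 2)) g₀ := by
      simpa using hasDerivAt_inv hg₀
    have h4 := ((hasDerivAt_flowMap hU hX hper).scomp g₀ h3).sub_const p
    refine h2.unique (h4.congr_of_eventuallyEq (Eventually.of_forall fun g => ?_))
    simp [F, Ft, J]
  -- the derivative along the transversal is given by the monodromy
  obtain ⟨v₁, hv₁, hA₂⟩ : ∃ v₁, det₂ (Y q₀ p) v₁ =
      Complex.exp (1 / g₀ * κ) * det₂ (Y q₀ p) e ∧ fderiv ℂ F u₀ (0, (0, 1)) = v₁ - e := by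
    obtain ⟨c, hc0, hc1, hc⟩ := id hper
    obtain ⟨v, hv0, hv1, hv⟩ := (flow_family_regularity hB hU hY hq₀ hc).2.2 e
    refine ⟨v 1, ?_, ?_⟩
    · have := det₂_variational_eq hU hX hdiv hc hv
      rwa [hc0, hc1, hv0] at this
    · rw [hc0, ← hJ₀] at hv1
      rw [hv1]
      have h1 : HasDerivAt (fun ζ : ℂ => ((q₀, (g₀, ζ)) : Q × (ℂ × ℂ))) (0, (0, 1)) 0 :=
        (hasDerivAt_const _ q₀).prodMk ((hasDerivAt_const _ g₀).prodMk (hasDerivAt_id 0))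
      have h2 : HasDerivAt (fun ζ : ℂ => F (q₀, (g₀, ζ))) (fderiv ℂ F u₀ (0, (0, 1))) 0 :=
        hFd.comp_hasDerivAt (0 : ℂ) h1
      have h3 : HasDerivAt (fun ζ : ℂ => p + ζ • e) e 0 := by
        simpa using ((hasDerivAt_id (0 : ℂ)).smul_const e).const_add p
      have h4 : HasDerivAt (fun ζ : ℂ => J (q₀, (g₀, ζ))) ((0, 0), e) 0 :=
        ((hasDerivAt_const _ q₀).prodMk (hasDerivAt_const _ (1 / g₀))).prodMk h3
      have h5 := (hFtd.comp_hasDerivAt (0 : ℂ) h4).sub h3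
      exact h2.unique h5
  have hinv : (fderiv ℂ F u₀ ∘L .inr ℂ Q (ℂ × ℂ)).IsInvertible := by
    refine isInvertible_of_injective ((injective_iff_map_eq_zero _).2 ?_)
    rintro ⟨a, b⟩ hab
    have h1 : a • (-(1 / g₀ ^ 2)) • Y q₀ p + b • (v₁ - e) = 0 := by
      rw [← hA₁, ← hA₂, ← map_smul, ← map_smul, ← map_add, ← hab]
      simp
    have h2 : b * ((Complex.exp (1 / g₀ * κ) - 1) * det₂ (Y q₀ p) e) = 0 := by
      have h3 := congrArg (det₂ (Y q₀ p)) h1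
      simp only [det₂, Prod.fst_add, Prod.snd_add, Prod.smul_fst, Prod.smul_snd, smul_eq_mul,
        Prod.fst_sub, Prod.snd_sub, Prod.fst_zero, Prod.snd_zero] at h3 hv₁ ⊢
      linear_combination h3 - b * hv₁
    have hb : b = 0 := by
      exact (mul_eq_zero.1 h2).resolve_right (mul_ne_zero (sub_ne_zero.2 hκ) he)
    have hp : Y q₀ p ≠ 0 := fun h => he (by simp [h, det₂])
    have ha : a = 0 := by
      simpa [hb, hg₀, hp] using h1
    simp [ha, hb]
  set G := hF.implicitFunction one_ne_zero hinv with hG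
  have hG₀ : G q₀ = (g₀, 0) := hF.implicitFunction_apply_self one_ne_zero hinv
  have hGd : ContDiffAt ℂ 1 G q₀ := hF.contDiffAt_implicitFunction one_ne_zero hinv
  have hGt : Tendsto (fun q => (q, G q)) (𝓝 q₀) (𝓝 u₀) := by
    have := (continuousAt_id (x := q₀)).prodMk hGd.continuousAt
    rwa [ContinuousAt, hG₀] at this
  have hFlow : ∀ᶠ u in 𝓝 u₀, FlowEq (Y u.1) U (1 / u.2.1) (p + u.2.2 • e) (Ft (J u)) := by
    have h1 := eventually_flowEq_flowMap hB hU hY hq₀ hper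
    rw [← hJ₀] at h1
    exact hJd.continuousAt.eventually h1
  have hBev : ∀ᶠ u : Q × (ℂ × ℂ) in 𝓝 u₀, u.1 ∈ B :=
    continuous_fst.continuousAt.eventually_mem (hB.mem_nhds hq₀)
  refine ⟨G, hG₀, hGd, ?_, ?_⟩
  · filter_upwards [hF.eventually_apply_implicitFunction one_ne_zero hinv,
      hGt.eventually hFlow] with q hq hqF
    rw [hF₀] at hq
    have h1 : Ft (J (q, G q)) = p + (G q).2 • e := sub_eq_zero.1 hq
    rwa [h1] at hqF
  · filter_upwards [hF.eventually_apply_eq_iff_implicitFunction one_ne_zero hinv, hBev]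
      with u hu huB hflow
    refine (hu.1 ?_).symm
    rw [hF₀]
    exact sub_eq_zero.2 (hflow.flowMap_eq hU (differentiableOn_section hY huB))

end Continuation

/-! ### Periodic flows, strips and annuli -/

section PeriodicExtension

variable {X : ℂ × ℂ → ℂ × ℂ} {U : Set (ℂ × ℂ)} {g : ℂ} {p : ℂ × ℂ} {s : ℝ}

/-- The curve `θ ↦ φ^{θ / g}_X (p)` on `0 ≤ Re θ < 1`, extended to `ℂ` with period `1`. -/
noncomputable def periodicFlow (X : ℂ × ℂ → ℂ × ℂ) (U : Set (ℂ × ℂ)) (g : ℂ) (p : ℂ × ℂ)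
    (θ : ℂ) : ℂ × ℂ :=
  flowMap X U ((θ - ⌊θ.re⌋) / g) p

theorem periodic_periodicFlow (X : ℂ × ℂ → ℂ × ℂ) (U : Set (ℂ × ℂ)) (g : ℂ) (p : ℂ × ℂ) :
    Function.Periodic (periodicFlow X U g p) 1 := by
  intro θ
  simp [periodicFlow]

theorem isOpen_strip (s : ℝ) : IsOpen (strip s) :=
  isOpen_lt (Complex.continuous_im.abs) continuous_const

theorem hasDerivAt_flowMap_div (hU : IsOpen U) (hX : DifferentiableOn ℂ X U) {θ : ℂ}
    {y : ℂ × ℂ} (h : FlowEq X U (θ / g) p y) :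
    HasDerivAt (fun θ => flowMap X U (θ / g) p) (g⁻¹ • X (flowMap X U (θ / g) p)) θ := by
  have h1 : HasDerivAt (fun θ : ℂ => θ / g) g⁻¹ θ := by
    simpa using (hasDerivAt_id θ).div_const g
  exact (hasDerivAt_flowMap hU hX h.flowEq_flowMap).scomp θ h1

/-- If the flow of `p` closes up at the time `1 / g`, and if it is defined for the times `θ / g`
with `θ` in a rectangle that exceeds a fundamental domain of the translation by `1`, then it is
defined for the times `θ / g` with `θ` in the whole strip, and it is periodic. -/
theorem flowEq_periodicFlow (hU : IsOpen U) (hX : DifferentiableOn ℂ X U) (hs : 0 < s)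
    (hper : FlowEq X U (1 / g) p p)
    (hrect : ∀ θ ∈ strip s, θ.re ∈ Icc (-1 : ℝ) 2 →
      FlowEq X U (θ / g) p (flowMap X U (θ / g) p)) :
    ∀ θ ∈ strip s, FlowEq X U (θ / g) p (periodicFlow X U g p θ) := by
  set ψ : ℂ → ℂ × ℂ := fun θ => flowMap X U (θ / g) p with hψ
  have hder : ∀ θ ∈ strip s, θ.re ∈ Icc (-1 : ℝ) 2 → HasDerivAt ψ (g⁻¹ • X (ψ θ)) θ :=
    fun θ hθ hre => hasDerivAt_flowMap_div hU hX (hrect θ hθ hre)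
  have hψ0 : ψ 0 = p := by
    have h1 := hrect 0 (by simpa [strip] using hs) (by simp)
    have h2 : FlowEq X U (0 / g) p p := ⟨fun _ => p, rfl, rfl, fun r _ => ⟨h1.mem_left, by
      rw [zero_div, zero_smul]; exact hasDerivWithinAt_const r (Icc 0 1) p⟩⟩
    exact h2.flowMap_eq hU hX
  have hψ1 : ψ 1 = p := hper.flowMap_eq hU hX
  -- periodicity where both sides are known to be defined, by uniqueness of the flow from `p`
  have hstep : ∀ θ ∈ strip s, θ.re ∈ Icc (-1 : ℝ) 1 → ψ (1 + θ) = ψ θ := by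
    intro θ hθ hre
    have h1 : FlowEq X U (g⁻¹ * θ) (ψ 1) (ψ (1 + θ)) := by
      refine flowEq_of_hasDerivAt fun r hr => ?_
      have hmem : 1 + r * θ ∈ strip s := by
        have hθ' : |θ.im| < s := hθ
        have : |r * θ.im| < s := by
          rw [abs_mul, abs_of_nonneg hr.1]
          exact (mul_le_of_le_one_left (abs_nonneg _) hr.2).trans_lt hθ'
        simpa [strip] using this
      have hre' : (1 + r * θ).re ∈ Icc (-1 : ℝ) 2 := by
        simp only [Complex.add_re, Complex.one_re, Complex.re_ofReal_mul, mem_Icc]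
        constructor <;> nlinarith [hr.1, hr.2, hre.1, hre.2]
      exact ⟨(hrect _ hmem hre').mem_right, hder _ hmem hre'⟩
    rw [hψ1, inv_mul_eq_div] at h1
    exact (h1.flowMap_eq hU hX).symm
  have hstrip : ∀ {θ : ℂ} (n : ℤ), θ ∈ strip s → θ - n ∈ strip s := fun n h => by
    simpa [strip] using h
  -- near every point of the strip, the extension is a translate of the flow
  have hloc : ∀ θ₀ ∈ strip s,
      periodicFlow X U g p =ᶠ[𝓝 θ₀] fun θ => ψ (θ - (⌊θ₀.re⌋ : ℤ)) := by
    intro θ₀ hθ₀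
    have hnear : ∀ᶠ θ : ℂ in 𝓝 θ₀, |θ.re - θ₀.re| < 1 / 2 := by
      have : Continuous fun θ : ℂ => |θ.re - θ₀.re| := by fun_prop
      exact this.continuousAt.eventually_lt continuousAt_const (by simp)
    filter_upwards [hnear, (isOpen_strip s).mem_nhds hθ₀] with θ hθ hθs
    rw [abs_lt] at hθ
    set n := ⌊θ₀.re⌋ with hn
    have hn1 := Int.floor_le θ₀.re
    have hn2 := Int.lt_floor_add_one θ₀.re
    have hm1 := Int.floor_le θ.re
    have hm2 := Int.lt_floor_add_one θ.re
    set m := ⌊θ.re⌋ with hm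
    rw [← hn] at hn1 hn2
    change ψ (θ - m) = ψ (θ - n)
    have hlow : n - 1 ≤ m := by
      rw [← Int.lt_add_one_iff]
      exact_mod_cast (by push_cast; linarith : ((n - 1 : ℤ) : ℝ) < (m + 1 : ℤ))
    have hupp : m ≤ n + 1 := by
      rw [← Int.lt_add_one_iff]
      exact_mod_cast (by push_cast; linarith : (m : ℝ) < (n + 1 + 1 : ℤ))
    obtain h | h | h : m = n - 1 ∨ m = n ∨ m = n + 1 := by omega
    · rw [show θ - (m : ℂ) = 1 + (θ - n) by rw [h]; push_cast; ring]
      refine hstep _ (hstrip n hθs) ?_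
      have : (m : ℝ) = n - 1 := by exact_mod_cast congrArg (Int.cast (R := ℝ)) h
      simp only [Complex.sub_re, Complex.intCast_re, mem_Icc]
      constructor <;> linarith
    · rw [h]
    · rw [show θ - (n : ℂ) = 1 + (θ - m) by rw [h]; push_cast; ring]
      refine (hstep _ (hstrip m hθs) ?_).symm
      simp only [Complex.sub_re, Complex.intCast_re, mem_Icc]
      constructor <;> linarith
  have hloc0 : ∀ θ ∈ strip s, periodicFlow X U g p θ ∈ U ∧
      HasDerivAt (periodicFlow X U g p) (g⁻¹ • X (periodicFlow X U g p θ)) θ := by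
    intro θ hθ
    have hre : (θ - (⌊θ.re⌋ : ℤ)).re ∈ Icc (-1 : ℝ) 2 := by
      have h1 := Int.floor_le θ.re
      have h2 := Int.lt_floor_add_one θ.re
      simp only [Complex.sub_re, Complex.intCast_re, mem_Icc]
      constructor <;> linarith
    have h1 := hder _ (hstrip ⌊θ.re⌋ hθ) hre
    refine ⟨(hrect _ (hstrip ⌊θ.re⌋ hθ) hre).mem_right, ?_⟩
    exact (h1.comp_sub_const θ _).congr_of_eventuallyEq (hloc θ hθ)
  intro θ hθ
  have h1 : FlowEq X U (g⁻¹ * θ) (periodicFlow X U g p 0) (periodicFlow X U g p (0 + θ)) := by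
    refine flowEq_of_hasDerivAt fun r hr => hloc0 _ ?_
    have hθ' : |θ.im| < s := hθ
    have : |r * θ.im| < s := by
      rw [abs_mul, abs_of_nonneg hr.1]
      exact (mul_le_of_le_one_left (abs_nonneg _) hr.2).trans_lt hθ'
    simpa [strip] using this
  have h0 : periodicFlow X U g p 0 = p := by
    have : periodicFlow X U g p 0 = ψ 0 := by simp [periodicFlow, hψ]
    rw [this, hψ0]
  rwa [h0, zero_add, inv_mul_eq_div] at h1

end PeriodicExtension

section Annulus

variable {X : ℂ × ℂ → ℂ × ℂ} {U : Set (ℂ × ℂ)} {g : ℂ} {p : ℂ × ℂ} {s s' : ℝ}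

theorem isOpenQuotientMap_cylinder : IsOpenQuotientMap (fun θ : ℂ => (θ : Cylinder)) :=
  QuotientAddGroup.isOpenQuotientMap_mk

theorem cylinder_coe_eq_iff {θ θ' : ℂ} :
    (θ : Cylinder) = (θ' : Cylinder) ↔ ∃ n : ℤ, θ - θ' = n := by
  rw [QuotientAddGroup.eq, AddSubgroup.mem_zmultiples_iff]
  constructor
  · rintro ⟨n, hn⟩
    refine ⟨-n, ?_⟩
    rw [zsmul_one] at hn
    push_cast
    linear_combination hn
  · rintro ⟨n, hn⟩
    refine ⟨-n, ?_⟩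
    rw [zsmul_one]
    push_cast
    linear_combination hn

/-- A continuous injective map on an open annulus is an embedding of every smaller annulus, which is
contained in a compact one. -/
theorem isEmbedding_of_injOn_annulus {Ψ : Cylinder → ℂ × ℂ} (hs : s' < s)
    (hcont : ContinuousOn Ψ (annulus s)) (hinj : InjOn Ψ (annulus s)) :
    Topology.IsEmbedding ((annulus s').domRestrict Ψ) := by
  let K : Set Cylinder := (fun θ : ℂ => (θ : Cylinder)) '' (Icc 0 1 ×ℂ Icc (-s') s')
  have hK : IsCompact K :=
    (isCompact_Icc.reProdIm isCompact_Icc).image isOpenQuotientMap_cylinder.continuous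
  have hKs : K ⊆ annulus s := by
    rintro _ ⟨θ, hθ, rfl⟩
    exact ⟨θ, (abs_le.2 hθ.2).trans_lt hs, rfl⟩
  have hsK : annulus s' ⊆ K := by
    rintro _ ⟨θ, hθ, rfl⟩
    refine ⟨θ - ⌊θ.re⌋, ⟨?_, ?_⟩, cylinder_coe_eq_iff.2 ⟨-⌊θ.re⌋, by push_cast; ring⟩⟩
    · have h1 := Int.floor_le θ.re
      have h2 := Int.lt_floor_add_one θ.re
      simp only [mem_preimage, Complex.sub_re, Complex.intCast_re, mem_Icc]
      constructor <;> linarith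
    · have : |θ.im| < s' := hθ
      simpa using abs_le.1 this.le
  have : CompactSpace K := isCompact_iff_compactSpace.1 hK
  have hKe : Topology.IsEmbedding (K.domRestrict Ψ) :=
    ((hcont.mono hKs).domRestrict.isClosedEmbedding
      (injOn_iff_injective.1 (hinj.mono hKs))).isEmbedding
  exact hKe.comp (Topology.IsEmbedding.inclusion hsK)

/-- The parametrization of the annulus by the complex-time flow. -/
noncomputable def annulusMap (X : ℂ × ℂ → ℂ × ℂ) (U : Set (ℂ × ℂ)) (g : ℂ) (p : ℂ × ℂ) :
    Cylinder → ℂ × ℂ :=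
  (periodic_periodicFlow X U g p).lift

@[simp]
theorem annulusMap_coe (X : ℂ × ℂ → ℂ × ℂ) (U : Set (ℂ × ℂ)) (g : ℂ) (p : ℂ × ℂ) (θ : ℂ) :
    annulusMap X U g p (θ : Cylinder) = periodicFlow X U g p θ := rfl

theorem isInvariantAnnulus_annulusMap (hU : IsOpen U) (hX : DifferentiableOn ℂ X U)
    (hg : g ≠ 0) (hp : X p ≠ 0) (hs : s' < s)
    (hflow : ∀ θ ∈ strip s, FlowEq X U (θ / g) p (periodicFlow X U g p θ))
    (hinj : ∀ θ ∈ strip s, ∀ θ' ∈ strip s,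
      periodicFlow X U g p θ = periodicFlow X U g p θ' → ∃ n : ℤ, θ - θ' = n) :
    IsInvariantAnnulus X U s' g (annulusMap X U g p) := by
  have hsub : strip s' ⊆ strip s := fun θ (hθ : |θ.im| < s') => hθ.trans hs
  have hder : ∀ θ ∈ strip s, HasDerivAt (periodicFlow X U g p)
      (g⁻¹ • X (periodicFlow X U g p θ)) θ := by
    intro θ hθ
    have h1 := hasDerivAt_flowMap_div hU hX (hflow θ hθ)
    rw [(hflow θ hθ).flowMap_eq hU hX] at h1
    refine h1.congr_of_eventuallyEq ?_
    filter_upwards [(isOpen_strip s).mem_nhds hθ] with θ' hθ'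
    exact ((hflow θ' hθ').flowMap_eq hU hX).symm
  refine ⟨?_, isEmbedding_of_injOn_annulus hs ?_ ?_, fun θ hθ =>
    ⟨g⁻¹ • X (periodicFlow X U g p θ), ?_, ?_, ?_⟩⟩
  · rintro _ ⟨θ, hθ, rfl⟩
    exact (hflow θ (hsub hθ)).mem_right
  · rintro _ ⟨θ, hθ, rfl⟩
    refine ContinuousAt.continuousWithinAt ?_
    rw [ContinuousAt, ← isOpenQuotientMap_cylinder.isOpenMap.map_nhds_eq
      isOpenQuotientMap_cylinder.continuous.continuousAt, tendsto_map'_iff]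
    exact (hder θ hθ).continuousAt
  · rintro _ ⟨θ, hθ, rfl⟩ _ ⟨θ', hθ', rfl⟩ h
    exact cylinder_coe_eq_iff.2 (hinj θ hθ θ' hθ' h)
  · exact smul_ne_zero (inv_ne_zero hg) ((hflow θ (hsub hθ)).ne_zero hU hX hp)
  · exact hder θ (hsub hθ)
  · rw [annulusMap_coe, smul_inv_smul₀ hg]

end Annulus

section Injectivity

variable {Q F : Type*} [NormedAddCommGroup Q] [NormedSpace ℂ Q] [NormedAddCommGroup F]
  [NormedSpace ℂ F]

/-- If the curve `H (q₀, ·)` is immersed and injective on real intervals of length `1 / 2`, then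
so are, uniformly, its complex extensions `H (q, ·)` with `q` close to `q₀`. -/
theorem eventually_injective {H : Q × ℂ → F} {q₀ : Q}
    (hH : ∀ t : ℝ, ContDiffAt ℂ 1 H (q₀, t))
    (himm : ∀ t : ℝ, ∃ v, v ≠ 0 ∧ HasDerivAt (fun θ => H (q₀, θ)) v t)
    (hinj : ∀ t d : ℝ, |d| ≤ 1 / 2 → H (q₀, t + d) = H (q₀, t) → d = 0) :
    ∀ᶠ x : Q × ℂ × ℂ in 𝓝 (q₀, 0, 0), ∀ y ∈ Icc (0 : ℝ) 1 ×ˢ Icc (-(1 / 2) : ℝ) (1 / 2),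
      H (x.1, y.1 + y.2 + x.2.1) = H (x.1, y.1 + x.2.2) → y.2 + x.2.1 = x.2.2 := by
  refine (isCompact_Icc.prod isCompact_Icc).eventually_forall_of_forall_eventually ?_
  rintro ⟨t, d⟩ ⟨-, hd⟩
  have hd' : |d| ≤ 1 / 2 := abs_le.2 hd
  have ha : Tendsto (fun z : (Q × ℂ × ℂ) × ℝ × ℝ =>
      ((z.1.1, (z.2.1 : ℂ) + z.2.2 + z.1.2.1) : Q × ℂ)) (𝓝 ((q₀, 0, 0), (t, d)))
      (𝓝 (q₀, ((t + d : ℝ) : ℂ))) := by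
    have h1 : Continuous fun z : (Q × ℂ × ℂ) × ℝ × ℝ =>
      ((z.1.1, (z.2.1 : ℂ) + z.2.2 + z.1.2.1) : Q × ℂ) := by fun_prop
    simpa using h1.tendsto ((q₀, 0, 0), (t, d))
  have hb : Tendsto (fun z : (Q × ℂ × ℂ) × ℝ × ℝ =>
      ((z.1.1, (z.2.1 : ℂ) + z.1.2.2) : Q × ℂ)) (𝓝 ((q₀, 0, 0), (t, d)))
      (𝓝 (q₀, (t : ℂ))) := by
    have h1 : Continuous fun z : (Q × ℂ × ℂ) × ℝ × ℝ =>
      ((z.1.1, (z.2.1 : ℂ) + z.1.2.2) : Q × ℂ) := by fun_prop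
    simpa using h1.tendsto ((q₀, 0, 0), (t, d))
  rcases eq_or_ne d 0 with rfl | hd0
  · -- near the diagonal, strict differentiability gives local injectivity, uniformly in `q`
    obtain ⟨v, hv, hvd⟩ := himm t
    have hs := (hH t).hasStrictFDerivAt one_ne_zero
    have hL : fderiv ℂ H (q₀, t) (0, 1) = v := by
      have h1 : HasDerivAt (fun θ : ℂ => ((q₀, θ) : Q × ℂ)) (0, 1) (t : ℂ) :=
        (hasDerivAt_const _ q₀).prodMk (hasDerivAt_id _)
      exact (hs.hasFDerivAt.comp_hasDerivAt (t : ℂ) h1).unique hvd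
    have hv' : 0 < ‖v‖ := norm_pos_iff.2 hv
    have h2 := Asymptotics.isLittleO_iff.1 hs.isLittleO (half_pos hv')
    simp only [add_zero] at ha
    filter_upwards [(ha.prodMk_nhds hb).eventually h2] with z hz heq
    rw [heq, sub_self, zero_sub, norm_neg, Prod.mk_sub_mk, sub_self] at hz
    set η : ℂ := (z.2.1 : ℂ) + z.2.2 + z.1.2.1 - (z.2.1 + z.1.2.2) with hη
    have h3 : ((0 : Q), η) = η • ((0 : Q), (1 : ℂ)) := by simp
    rw [h3, map_smul, hL, norm_smul, ← h3, Prod.norm_mk, norm_zero,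
      max_eq_right (norm_nonneg _)] at hz
    have h4 : ‖η‖ = 0 := by nlinarith [norm_nonneg η]
    have h5 : η = 0 := norm_eq_zero.1 h4
    rw [hη] at h5
    linear_combination h5
  · -- away from the diagonal, the two values stay apart
    have hne : H (q₀, ((t + d : ℝ) : ℂ)) ≠ H (q₀, (t : ℂ)) := fun h =>
      hd0 (hinj t d hd' (by simpa using h))
    have h1 := ((hH (t + d)).continuousAt.tendsto.comp ha)
    have h2 := ((hH t).continuousAt.tendsto.comp hb)
    filter_upwards [(h1.prodMk_nhds h2).eventually
      (isClosed_diagonal.isOpen_compl.mem_nhds hne)] with z hz heq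
    exact absurd heq hz

end Injectivity

/-! ### Invariant annuli of the perturbed vector fields -/

section AnnulusFamily

variable {Q : Type*} [NormedAddCommGroup Q] [NormedSpace ℂ Q] [CompleteSpace Q]
  {Y : Q → ℂ × ℂ → ℂ × ℂ} {B : Set Q} {U : Set (ℂ × ℂ)}

theorem contDiffAt_flowMap_curve (hB : IsOpen B) (hU : IsOpen U)
    (hY : DifferentiableOn ℂ (fun z : Q × (ℂ × ℂ) => Y z.1 z.2) (B ×ˢ U)) {p e y : ℂ × ℂ}
    {G : Q → ℂ × ℂ} {q : Q} (hq : q ∈ B) (hG : ContDiffAt ℂ 1 G q) (hg : (G q).1 ≠ 0) {θ : ℂ}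
    (h : FlowEq (Y q) U (θ / (G q).1) (p + (G q).2 • e) y) :
    ContDiffAt ℂ 1 (fun w : Q × ℂ => flowMap (Y w.1) U (w.2 / (G w.1).1) (p + (G w.1).2 • e))
      (q, θ) := by
  have hG' : ContDiffAt ℂ 1 (fun w : Q × ℂ => G w.1) (q, θ) :=
    ContDiffAt.comp (q, θ) (g := G) hG contDiffAt_fst
  have h1 : ContDiffAt ℂ 1 (fun w : Q × ℂ => w.2 / (G w.1).1) (q, θ) :=
    contDiffAt_snd.div hG'.fst hg
  have h2 : ContDiffAt ℂ 1 (fun w : Q × ℂ => p + (G w.1).2 • e) (q, θ) :=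
    contDiffAt_const.add (hG'.snd.smul contDiffAt_const)
  exact ContDiffAt.comp (q, θ) (f := fun w : Q × ℂ =>
    ((w.1, w.2 / (G w.1).1), p + (G w.1).2 • e)) (contDiffAt_flowMap hB hU hY hq h)
    ((contDiffAt_fst.prodMk h1).prodMk h2)

/-- Two times at which a periodic orbit passes through the same point differ by at least the
minimal period. -/
theorem IsPeriodicOrbit.eq_zero_of_eq {X : ℂ × ℂ → ℂ × ℂ} {T : ℝ} {γ : ℝ → ℂ × ℂ}
    (hγ : IsPeriodicOrbit X T γ) (hU : IsOpen U) (hX : DifferentiableOn ℂ X U)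
    (hγU : ∀ t, γ t ∈ U) {a d : ℝ} (hd : |d| < |T|) (h : γ (a + d) = γ a) : d = 0 := by
  have hflow := flowEq_of_integralCurve hγ.solution hγU
  -- by uniqueness of the flow from the common point, the difference of the two times is a period
  have h1 : γ d = γ 0 := by
    have e1 := hflow (a + d) d
    have e2 := hflow a 0
    rw [h] at e1
    rw [show d - (a + d) = 0 - a by ring] at e1
    exact e1.unique hU hX e2
  have h2 : γ (-d) = γ 0 := by
    have e1 := hflow d 0
    have e2 := hflow 0 (-d)
    rw [h1] at e1
    rw [show 0 - d = -d - 0 by ring] at e1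
    exact e2.unique hU hX e1
  rcases lt_trichotomy d 0 with hneg | h0 | hpos
  · exact absurd h2 (hγ.minimal (-d) (by linarith) (by rwa [abs_of_neg hneg] at hd))
  · exact h0
  · exact absurd h1 (hγ.minimal d hpos (by rwa [abs_of_pos hpos] at hd))

/-- A family of periodic orbits which continues a real periodic orbit of minimal period extends to
complex times in a uniform strip, and parametrizes annuli there. -/
theorem exists_uniform_strip (hB : IsOpen B) (hU : IsOpen U)
    (hY : DifferentiableOn ℂ (fun z : Q × (ℂ × ℂ) => Y z.1 z.2) (B ×ˢ U))
    {q₀ : Q} (hq₀ : q₀ ∈ B) {gs : ℝ} {γ : ℝ → ℂ × ℂ} (hγ : IsPeriodicOrbit (Y q₀) (1 / gs) γ)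
    (hγU : ∀ t, γ t ∈ U) (hX₀ : Y q₀ (γ 0) ≠ 0) {e : ℂ × ℂ} {G : Q → ℂ × ℂ}
    (hG₀ : G q₀ = ((gs : ℂ), 0)) (hG : ContDiffAt ℂ 1 G q₀)
    (hper : ∀ᶠ q in 𝓝 q₀,
      FlowEq (Y q) U (1 / (G q).1) (γ 0 + (G q).2 • e) (γ 0 + (G q).2 • e)) :
    ∃ s > 0, ∀ᶠ q in 𝓝 q₀, ContDiffAt ℂ 1 G q ∧ (G q).1 ≠ 0 ∧ Y q (γ 0 + (G q).2 • e) ≠ 0 ∧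
      (∀ θ ∈ strip s, FlowEq (Y q) U (θ / (G q).1) (γ 0 + (G q).2 • e)
        (periodicFlow (Y q) U (G q).1 (γ 0 + (G q).2 • e) θ)) ∧
      ∀ θ ∈ strip s, ∀ θ' ∈ strip s,
        periodicFlow (Y q) U (G q).1 (γ 0 + (G q).2 • e) θ =
          periodicFlow (Y q) U (G q).1 (γ 0 + (G q).2 • e) θ' → ∃ n : ℤ, θ - θ' = n := by
  have hX := differentiableOn_section hY hq₀
  have hgs : gs ≠ 0 := fun h => hγ.period_ne_zero (by simp [h])
  have hgs' : (G q₀).1 ≠ 0 := by simpa [hG₀] using hgs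
  have hp₀ : γ 0 + (G q₀).2 • e = γ 0 := by simp [hG₀]
  let H : Q × ℂ → ℂ × ℂ := fun w => flowMap (Y w.1) U (w.2 / (G w.1).1) (γ 0 + (G w.1).2 • e)
  have hbase : ∀ t : ℝ,
      FlowEq (Y q₀) U (t / (G q₀).1) (γ 0 + (G q₀).2 • e) (γ (t / gs)) := by
    intro t
    have := flowEq_of_integralCurve hγ.solution hγU 0 (t / gs)
    rw [hp₀, hG₀]
    simpa using this
  have hH₀ : ∀ t : ℝ, H (q₀, t) = γ (t / gs) := fun t => (hbase t).flowMap_eq hU hX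
  have hH : ∀ t : ℝ, ContDiffAt ℂ 1 H (q₀, t) := fun t =>
    contDiffAt_flowMap_curve hB hU hY hq₀ hG hgs' (hbase t)
  have hdom : ∀ t : ℝ, ∀ᶠ w : Q × ℂ in 𝓝 (q₀, (t : ℂ)),
      FlowEq (Y w.1) U (w.2 / (G w.1).1) (γ 0 + (G w.1).2 • e) (H w) := by
    intro t
    have hGc : ContinuousAt (fun w : Q × ℂ => G w.1) (q₀, (t : ℂ)) :=
      ContinuousAt.comp (g := G) hG.continuousAt continuousAt_fst
    have h1 : ContinuousAt (fun w : Q × ℂ => ((w.1, w.2 / (G w.1).1), γ 0 + (G w.1).2 • e))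
        (q₀, (t : ℂ)) :=
      (continuousAt_fst.prodMk (continuousAt_snd.div hGc.fst hgs')).prodMk
        (continuousAt_const.add (hGc.snd.smul continuousAt_const))
    exact h1.eventually (eventually_flowEq_flowMap hB hU hY hq₀ (hbase t))
  have hrect : ∀ᶠ w : Q × ℂ in 𝓝 (q₀, 0), ∀ t ∈ Icc (-1 : ℝ) 2,
      FlowEq (Y w.1) U ((t + w.2) / (G w.1).1) (γ 0 + (G w.1).2 • e) (H (w.1, t + w.2)) := by
    refine isCompact_Icc.eventually_forall_of_forall_eventually fun t _ => ?_
    have h1 : Tendsto (fun z : (Q × ℂ) × ℝ => ((z.1.1, (z.2 : ℂ) + z.1.2) : Q × ℂ))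
        (𝓝 ((q₀, 0), t)) (𝓝 (q₀, (t : ℂ))) := by
      have h2 : Continuous fun z : (Q × ℂ) × ℝ => ((z.1.1, (z.2 : ℂ) + z.1.2) : Q × ℂ) := by
        fun_prop
      simpa using h2.tendsto ((q₀, 0), t)
    exact h1.eventually (hdom t)
  have hinj := eventually_injective (H := H) hH
    (fun t => ⟨((G q₀).1)⁻¹ • Y q₀ (γ (t / gs)),
      smul_ne_zero (inv_ne_zero hgs') ((hbase t).ne_zero hU hX (by rwa [hp₀])), by
        have := hasDerivAt_flowMap_div hU hX (hbase t)
        rwa [(hbase t).flowMap_eq hU hX] at this⟩)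
    (fun t d hd h => by
      rw [← Complex.ofReal_add, hH₀, hH₀, add_div] at h
      have h1 := hγ.eq_zero_of_eq hU hX hγU (d := d / gs) (by
        rw [abs_div, abs_div, abs_one]
        have := abs_pos.2 hgs
        gcongr
        linarith) h
      exact (div_eq_zero_iff.1 h1).resolve_right hgs)
  have hsing : ∀ᶠ q in 𝓝 q₀, Y q (γ 0 + (G q).2 • e) ≠ 0 := by
    have h1 : ContinuousAt (fun q => (q, γ 0 + (G q).2 • e)) q₀ :=
      continuousAt_id.prodMk (continuousAt_const.add (hG.continuousAt.snd.smul continuousAt_const))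
    have h2 : ContinuousAt (fun z : Q × (ℂ × ℂ) => Y z.1 z.2) (q₀, γ 0 + (G q₀).2 • e) := by
      rw [hp₀]
      exact (hY.differentiableAt ((hB.prod hU).mem_nhds ⟨hq₀, hγU 0⟩)).continuousAt
    have h3 := ContinuousAt.comp (f := fun q => (q, γ 0 + (G q).2 • e)) h2 h1
    exact h3.eventually_ne (by simpa [hp₀] using hX₀)
  have hgne : ∀ᶠ q in 𝓝 q₀, (G q).1 ≠ 0 := hG.continuousAt.fst.eventually_ne hgs'
  obtain ⟨s₁, hs₁, hrect⟩ := Metric.eventually_nhds_iff_ball.1 hrect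
  obtain ⟨s₂, hs₂, hinj⟩ := Metric.eventually_nhds_iff_ball.1 hinj
  have hs : 0 < min s₁ s₂ := lt_min hs₁ hs₂
  refine ⟨min s₁ s₂, hs, ?_⟩
  filter_upwards [hG.eventually (by simp), hgne, hsing, hper, hB.mem_nhds hq₀,
    ball_mem_nhds q₀ hs] with q hq1 hq2 hq3 hq4 hqB hqs
  have hXq := differentiableOn_section hY hqB
  have himI : ∀ θ ∈ strip (min s₁ s₂), ‖(θ.im : ℂ) * Complex.I‖ < min s₁ s₂ := fun θ hθ => by
    have : |θ.im| < min s₁ s₂ := hθ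
    simpa using this
  have hflow := flowEq_periodicFlow hU hXq hs hq4 fun θ hθ hre => by
    have := hrect (q, θ.im * Complex.I) (by
      rw [mem_ball, Prod.dist_eq]
      refine max_lt ((mem_ball.1 hqs).trans_le (min_le_left _ _)) ?_
      simpa only [dist_zero_right] using (himI θ hθ).trans_le (min_le_left _ _)) θ.re hre
    simpa only [Complex.re_add_im, H] using this
  refine ⟨hq1, hq2, hq3, hflow, fun θ hθ θ' hθ' heq => ?_⟩
  set ψ := periodicFlow (Y q) U (G q).1 (γ 0 + (G q).2 • e) with hψ
  have hψH : ∀ θ ∈ strip (min s₁ s₂), ψ θ = H (q, θ) := fun θ hθ =>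
    ((hflow θ hθ).flowMap_eq hU hXq).symm
  have hψper : ∀ (θ : ℂ) (n : ℤ), ψ (θ - n) = ψ θ := fun θ n => by
    simpa using (periodic_periodicFlow (Y q) U (G q).1 (γ 0 + (G q).2 • e)).sub_int_mul_eq n
      (x := θ)
  have hstrip : ∀ {θ : ℂ} (n : ℤ), θ ∈ strip (min s₁ s₂) → θ - n ∈ strip (min s₁ s₂) :=
    fun n h => by simpa [strip] using h
  -- translate `θ'` to `0 ≤ Re θ' ≤ 1` and `θ` to `|Re (θ - θ')| ≤ 1 / 2`
  set n := ⌊θ'.re⌋ with hn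
  set m := round (θ.re - (θ'.re - n)) with hm
  set d := θ.re - (θ'.re - n) - m with hd
  have hd' : |d| ≤ 1 / 2 := abs_sub_round _
  have hval : H (q, θ - m) = H (q, θ' - n) := by
    rw [← hψH _ (hstrip m hθ), ← hψH _ (hstrip n hθ'), hψper, hψper, heq]
  have e1 : θ - m = ((θ'.re - n : ℝ) : ℂ) + d + θ.im * Complex.I := by
    rw [hd]
    push_cast
    linear_combination -(Complex.re_add_im θ)
  have e2 : θ' - n = ((θ'.re - n : ℝ) : ℂ) + θ'.im * Complex.I := by
    push_cast
    linear_combination -(Complex.re_add_im θ')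
  have key := hinj (q, θ.im * Complex.I, θ'.im * Complex.I) (by
      rw [mem_ball, Prod.dist_eq, Prod.dist_eq]
      refine max_lt ((mem_ball.1 hqs).trans_le (min_le_right _ _)) (max_lt ?_ ?_)
      · simpa only [dist_zero_right] using (himI θ hθ).trans_le (min_le_right _ _)
      · simpa only [dist_zero_right] using (himI θ' hθ').trans_le (min_le_right _ _))
    (θ'.re - n, d) ⟨⟨by linarith [Int.floor_le θ'.re], by
      linarith [Int.lt_floor_add_one θ'.re]⟩, abs_le.1 hd'⟩
    (by simp only; rw [← e1, ← e2]; exact hval)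
  refine ⟨m - n, ?_⟩
  push_cast
  simp only at key
  linear_combination e1 - e2 + key

end AnnulusFamily

theorem exp_frequency_ne_one {gs : ℝ} (hgs : |gs + 0.834| ≤ 1 / 1000) :
    Complex.exp (1 / gs * (2 * Real.pi * Complex.I)) ≠ 1 := by
  rw [abs_le] at hgs
  have hneg : gs < 0 := by linarith [hgs.2]
  intro h
  obtain ⟨n, hn⟩ := Complex.exp_eq_one_iff.1 h
  have h1 : (1 / gs : ℂ) = n := mul_right_cancel₀ Complex.two_pi_I_ne_zero hn
  have h2 : (n : ℝ) * gs = 1 := by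
    have h3 : (1 / gs : ℝ) = n := by exact_mod_cast h1
    rw [← h3, one_div, inv_mul_cancel₀ hneg.ne]
  -- `n gs = 1` with `gs` close to `-0.834` would force `-2 < n < -1`
  have h3 : n < -1 := by
    by_contra! h
    have : (-1 : ℝ) ≤ n := by exact_mod_cast h
    nlinarith [hgs.1]
  have h4 : -2 < n := by
    by_contra! h
    have : (n : ℝ) ≤ -2 := by exact_mod_cast h
    nlinarith [hgs.2]
  omega

theorem theorem6p3
    -- a periodic orbit of `X_1` with real frequency `gs = -0.834 ± 10⁻³`, and `p_* = γ 0`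
    (gs : ℝ) (hgs : |gs + 0.834| ≤ 1 / 1000)
    (γ : ℝ → ℂ × ℂ) (hγ : IsPeriodicOrbit (modelField 1) (1 / gs) γ)
    (M : ℝ) (hM : ∀ t : ℝ, γ t ∈ ball (0 : ℂ × ℂ) (M / 2))
    -- a transverse direction at `p_*`
    (e : ℂ × ℂ)
    (he : IsCompl (Submodule.span ℂ {e}) (Submodule.span ℂ {modelField 1 (γ 0)}))
    -- the perturbation `X_{δ,τ'}`
    (β₀ : ℂ) (ν₀ : ℝ) (hν₀ : 0 < ν₀)
    (X : ℂ → ℂ × ℂ → ℂ × ℂ → ℂ × ℂ) (hX : IsPerturbation β₀ ν₀ M X) :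
    ∃ ν₁ ν₁' s : ℝ, 0 < ν₁ ∧ ν₁ ≤ ν₀ ∧ 0 < ν₁' ∧ 0 < s ∧
    ∃ g ζ : ℂ → ℂ × ℂ → ℂ, ∃ Ψ : ℂ → ℂ × ℂ → Cylinder → ℂ × ℂ,
      -- the frequency and the position depend holomorphically on the parameters
      DifferentiableOn ℂ (fun q : (ℂ × ℂ) × ℂ => g q.2 q.1)
        (ball ((1 : ℂ), β₀) ν₁ ×ˢ ball (0 : ℂ) ν₁) ∧
      DifferentiableOn ℂ (fun q : (ℂ × ℂ) × ℂ => ζ q.2 q.1)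
        (ball ((1 : ℂ), β₀) ν₁ ×ˢ ball (0 : ℂ) ν₁) ∧
      (∀ β ∈ ball β₀ ν₁, g 0 (1, β) = (gs : ℂ) ∧ ζ 0 (1, β) = 0) ∧
      -- `(g_δ(τ'), ζ_δ(τ'))` is the unique solution of the periodicity equation
      (∀ τ' ∈ ball ((1 : ℂ), β₀) ν₁, ∀ δ ∈ ball (0 : ℂ) ν₁,
        g δ τ' ∈ ball (gs : ℂ) ν₁' ∧ ζ δ τ' ∈ ball (0 : ℂ) ν₁' ∧
        FlowEq (X δ τ') (ball 0 M) (1 / g δ τ') (γ 0 + ζ δ τ' • e) (γ 0 + ζ δ τ' • e) ∧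
        ∀ g' ∈ ball (gs : ℂ) ν₁', ∀ ζ' ∈ ball (0 : ℂ) ν₁',
          FlowEq (X δ τ') (ball 0 M) (1 / g') (γ 0 + ζ' • e) (γ 0 + ζ' • e) →
            g' = g δ τ' ∧ ζ' = ζ δ τ') ∧
      -- the invariant annulus of uniform width, parametrized by the complex-time flow
      DifferentiableOn ℂ (fun q : (ℂ × ℂ) × ℂ × ℂ => Ψ q.2.1 q.1 (q.2.2 : Cylinder))
        (ball ((1 : ℂ), β₀) ν₁ ×ˢ ball (0 : ℂ) ν₁ ×ˢ strip s) ∧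
      (∀ τ' ∈ ball ((1 : ℂ), β₀) ν₁, ∀ δ ∈ ball (0 : ℂ) ν₁,
        IsInvariantAnnulus (X δ τ') (ball 0 M) s (g δ τ') (Ψ δ τ') ∧
        ∀ θ ∈ strip s,
          FlowEq (X δ τ') (ball 0 M) (θ / g δ τ') (γ 0 + ζ δ τ' • e)
            (Ψ δ τ' (θ : Cylinder))) := by
  let U : Set (ℂ × ℂ) := ball 0 M
  let Y : (ℂ × ℂ) × ℂ → ℂ × ℂ → ℂ × ℂ := fun q => X q.2 q.1
  let B : Set ((ℂ × ℂ) × ℂ) := ball ((1 : ℂ), β₀) ν₀ ×ˢ ball (0 : ℂ) ν₀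
  let q₀ : (ℂ × ℂ) × ℂ := ((1, β₀), 0)
  have hU : IsOpen U := isOpen_ball
  have hB : IsOpen B := isOpen_ball.prod isOpen_ball
  have hY : DifferentiableOn ℂ (fun z : ((ℂ × ℂ) × ℂ) × (ℂ × ℂ) => Y z.1 z.2) (B ×ˢ U) := by
    have h1 : DifferentiableOn ℂ (fun z : ((ℂ × ℂ) × ℂ) × (ℂ × ℂ) => (z.1.1, z.1.2, z.2))
        (B ×ˢ U) := by fun_prop
    exact hX.holomorphic.comp h1 fun z hz => ⟨hz.1.1, hz.1.2, hz.2⟩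
  have hq₀ : q₀ ∈ B := ⟨mem_ball_self hν₀, mem_ball_self hν₀⟩
  have hγU : ∀ t, γ t ∈ U := fun t => by
    have hMpos : 0 < M / 2 := pos_of_mem_ball (hM t)
    exact ball_subset_ball (by linarith) (hM t)
  have hunp : ∀ β ∈ ball β₀ ν₀, ∀ t, X 0 (1, β) (γ t) = modelField 1 (γ t) := fun β hβ t =>
    hX.unperturbed β hβ _ (hγU t)
  have hβ₀ : β₀ ∈ ball β₀ ν₀ := mem_ball_self hν₀
  have hg₀ : (gs : ℂ) ≠ 0 := fun h => hγ.period_ne_zero (by simp [Complex.ofReal_eq_zero.1 h])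
  have hdet : det₂ (Y q₀ (γ 0)) e ≠ 0 := by
    have := det₂_ne_zero_of_isCompl he
    rwa [← hunp β₀ hβ₀ 0] at this
  have hperβ : ∀ β ∈ ball β₀ ν₀, FlowEq (X 0 (1, β)) U (1 / gs) (γ 0) (γ 0) := by
    intro β hβ
    have h1 := flowEq_of_integralCurve (X := X 0 (1, β)) (U := U)
      (fun t => by rw [hunp β hβ t]; exact hγ.solution t) hγU 0 (1 / gs)
    have h2 : γ (1 / gs) = γ 0 := by simpa using hγ.periodic 0
    rw [h2] at h1
    simpa using h1
  have hγ' : IsPeriodicOrbit (Y q₀) (1 / gs) γ :=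
    ⟨hγ.period_ne_zero, fun t => by
      have := hγ.solution t
      rwa [← hunp β₀ hβ₀ t] at this, hγ.periodic, hγ.minimal⟩
  obtain ⟨G, hG₀, hG, hper, huniq⟩ := exists_periodic_continuation hB hU hY hq₀ hg₀
    (hperβ β₀ hβ₀) (fun x hx => hX.divergence_eq (1, β₀) hq₀.1 0 hq₀.2 x hx)
    (exp_frequency_ne_one hgs) hdet
  have hX₀ : Y q₀ (γ 0) ≠ 0 := fun h => hdet (by simp [h, det₂])
  obtain ⟨s, hs, hstrip⟩ := exists_uniform_strip hB hU hY hq₀ hγ' hγU hX₀ hG₀ hG hper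
  obtain ⟨ν', hν', huniq⟩ := Metric.eventually_nhds_iff_ball.1 huniq
  have hGball : ∀ᶠ q in 𝓝 q₀, G q ∈ ball ((gs : ℂ), (0 : ℂ)) ν' :=
    hG.continuousAt.eventually_mem (by rw [hG₀]; exact ball_mem_nhds _ hν')
  obtain ⟨ν, hν, hall⟩ := Metric.eventually_nhds_iff_ball.1 (hper.and (hstrip.and hGball))
  set ν₁ := min ν (min ν₀ ν') with hν₁def
  have hν₁ : 0 < ν₁ := lt_min hν (lt_min hν₀ hν')
  have hν₁₀ : ν₁ ≤ ν₀ := (min_le_right _ _).trans (min_le_left _ _)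
  have hball : ∀ {τ' : ℂ × ℂ} {δ : ℂ} {r : ℝ}, ν₁ ≤ r → τ' ∈ ball ((1 : ℂ), β₀) ν₁ →
      δ ∈ ball (0 : ℂ) ν₁ → (τ', δ) ∈ ball q₀ r := by
    intro τ' δ r hr h1 h2
    rw [← ball_prod_same]
    exact ⟨ball_subset_ball hr h1, ball_subset_ball hr h2⟩
  have hmem : ∀ {τ' : ℂ × ℂ} {δ : ℂ}, τ' ∈ ball ((1 : ℂ), β₀) ν₁ →
      δ ∈ ball (0 : ℂ) ν₁ → (τ', δ) ∈ ball q₀ ν := hball (min_le_left _ _)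
  have hmemB : ∀ {τ' : ℂ × ℂ} {δ : ℂ}, τ' ∈ ball ((1 : ℂ), β₀) ν₁ →
      δ ∈ ball (0 : ℂ) ν₁ → (τ', δ) ∈ B := fun h1 h2 =>
    ⟨ball_subset_ball hν₁₀ h1, ball_subset_ball hν₁₀ h2⟩
  have hun : ∀ {τ' : ℂ × ℂ} {δ : ℂ}, τ' ∈ ball ((1 : ℂ), β₀) ν₁ → δ ∈ ball (0 : ℂ) ν₁ →
      ∀ g' ∈ ball (gs : ℂ) ν', ∀ ζ' ∈ ball (0 : ℂ) ν',
        FlowEq (X δ τ') U (1 / g') (γ 0 + ζ' • e) (γ 0 + ζ' • e) → (g', ζ') = G (τ', δ) := by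
    intro τ' δ h1 h2 g' hg' ζ' hζ' hflow
    refine huniq ((τ', δ), (g', ζ')) ?_ hflow
    rw [← ball_prod_same, ← ball_prod_same (gs : ℂ)]
    exact ⟨hball ((min_le_right _ _).trans (min_le_right _ _)) h1 h2, hg', hζ'⟩
  refine ⟨ν₁, ν', s / 2, hν₁, hν₁₀, hν', half_pos hs, fun δ τ' => (G (τ', δ)).1,
    fun δ τ' => (G (τ', δ)).2, fun δ τ' => annulusMap (X δ τ') U (G (τ', δ)).1
      (γ 0 + (G (τ', δ)).2 • e), ?_, ?_, ?_, ?_, ?_, ?_⟩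
  · rintro ⟨τ', δ⟩ ⟨h1, h2⟩
    exact ((hall _ (hmem h1 h2)).2.1.1.differentiableAt one_ne_zero).fst.differentiableWithinAt
  · rintro ⟨τ', δ⟩ ⟨h1, h2⟩
    exact ((hall _ (hmem h1 h2)).2.1.1.differentiableAt one_ne_zero).snd.differentiableWithinAt
  · intro β hβ
    have h1 : ((1 : ℂ), β) ∈ ball ((1 : ℂ), β₀) ν₁ := by
      rw [← ball_prod_same]
      exact ⟨mem_ball_self hν₁, hβ⟩
    have h2 := hun h1 (mem_ball_self hν₁) gs (mem_ball_self hν') 0 (mem_ball_self hν')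
      (by simpa using hperβ β (ball_subset_ball hν₁₀ hβ))
    exact ⟨(congrArg Prod.fst h2).symm, (congrArg Prod.snd h2).symm⟩
  · intro τ' h1 δ h2
    have h3 := (hall _ (hmem h1 h2)).2.2
    rw [← ball_prod_same] at h3
    refine ⟨h3.1, h3.2, (hall _ (hmem h1 h2)).1, fun g' hg' ζ' hζ' hflow => ?_⟩
    have h4 := hun h1 h2 g' hg' ζ' hζ' hflow
    exact ⟨congrArg Prod.fst h4, congrArg Prod.snd h4⟩
  · let H : ((ℂ × ℂ) × ℂ) × ℂ → ℂ × ℂ := fun w =>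
      flowMap (Y w.1) U (w.2 / (G w.1).1) (γ 0 + (G w.1).2 • e)
    have hsub : strip (s / 2) ⊆ strip s := fun θ (hθ : |θ.im| < s / 2) =>
      hθ.trans (half_lt_self hs)
    have hH : DifferentiableOn ℂ (fun q : (ℂ × ℂ) × ℂ × ℂ => H ((q.1, q.2.1), q.2.2))
        (ball ((1 : ℂ), β₀) ν₁ ×ˢ ball (0 : ℂ) ν₁ ×ˢ strip (s / 2)) := by
      rintro ⟨τ', δ, θ⟩ ⟨h1, h2, h3⟩
      obtain ⟨hGq, hgq, -, hfl, -⟩ := (hall _ (hmem h1 h2)).2.1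
      have h4 := (contDiffAt_flowMap_curve hB hU hY (hmemB h1 h2) hGq hgq
        (hfl θ (hsub h3))).differentiableAt one_ne_zero
      exact (DifferentiableAt.comp (τ', δ, θ) (g := H)
        (f := fun q : (ℂ × ℂ) × ℂ × ℂ => ((q.1, q.2.1), q.2.2)) h4
        (by fun_prop)).differentiableWithinAt
    refine hH.congr ?_
    rintro ⟨τ', δ, θ⟩ ⟨h1, h2, h3⟩
    exact (((hall _ (hmem h1 h2)).2.1.2.2.2.1 θ (hsub h3)).flowMap_eq hU
      (differentiableOn_section hY (hmemB h1 h2))).symm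
  · intro τ' h1 δ h2
    obtain ⟨-, hgq, hne, hfl, hinj⟩ := (hall _ (hmem h1 h2)).2.1
    refine ⟨isInvariantAnnulus_annulusMap hU (differentiableOn_section hY (hmemB h1 h2)) hgq hne
      (half_lt_self hs) hfl hinj, fun θ (hθ : |θ.im| < s / 2) => ?_⟩
    exact hfl θ (hθ.trans (half_lt_self hs))
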